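/- **Conventions.** A net of order $n\ge 1$ and degree $k\ge 1$ is a set $P$ of $n^2$ points with a set $L$ of $kn$ lines (subsets of $P$) such that each line has $n$ points, each point lies on exactly $k$ lines, and the lines fall into $k$ parallel classes: two distinct lines of the same class are disjoint, and two lines of different classes share exactly one point. Its net graph ($k$-net graph of order $n$) has vertex set $P$, two distinct points being adjacent iff they lie on a common line. A graph on $N$ vertices is given by its $N\times N$ adjacency matrix, written row by row. Circuit families $(C_m)_{m\in\mathbb N}$ ($C_m$ reads $m$ bits and has several output bits) are logspace uniform: a deterministic Turing machine computes $1^m\mapsto\langle C_m\rangle$ with $O(\log m)$ work space. They have polynomial size and constant depth. The gates are unbounded fan-in $\mathsf{AND}$, $\mathsf{OR}$ and $\mathsf{NOT}$ for $\mathsf{AC}^0$, and additionally unbounded fan-in $\mathsf{Majority}$ for $\mathsf{TC}^0$. **Lemma.** Let $G$ be the net graph of a net $\mathcal N$ of order $n$ and degree $k$, on the $N=n^2$ vertices $\{0,\dots,N-1\}$, with $n>(k-1)^2$. 1. $\mathcal N$ can be reconstructed from $G$ in $\mathsf{TC}^0$: there is one logspace uniform $\mathsf{TC}^0$ family which, for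 all such $n,k,\mathcal N$, maps the adjacency matrix of $G$ to an $N\times N^2$ matrix over $\{0,1\}$ whose first $kn$ columns form the point-block incidence matrix of $\mathcal N$ (each line is listed exactly once, in some order) and whose other columns are $0$. 2. If $k$ is bounded, $\mathcal N$ can be reconstructed from $G$ in $\mathsf{AC}^0$: for every $K$ there is one logspace uniform $\mathsf{AC}^0$ family which, for all such $n,k,\mathcal N$ with $k\le K$, maps the adjacency matrix of $G$ to an $N\times N^2$ matrix over $\{0,1\}$ whose nonzero columns are the indicator vectors of the lines of $\mathcal N$, each line exactly once (zero columns may stand anywhere). 3. Let $u,v$ be adjacent points, and let $H$ be the subgraph of $G$ induced by $u$, $v$ and their common neighbours. There is exactly one line $\ell$ through $u$ and $v$. It is a clique contained in $H$; each point of $\ell$ has degree at least $n-1$ in $H$, and each vertex of $H$ outside $\ell$ has degree less than $(k-1)^2$ in $H$ (and $(k-1)^2\le n-1$). -/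

import Mathlib

/-! ### Boolean circuits -/

/-- The gate types; all of them except `not` have unbounded fan-in. -/
inductive GateKind
  | and
  | or
  | not
  | maj
  deriving DecidableEq

/-- A gate: its type and the list of the nodes that it reads. In a circuit on `m` input bits the
nodes `0, …, m - 1` are the inputs and node `m + i` is gate number `i`. -/
structure Gate where
  kind : GateKind
  args : List ℕ

/-- A circuit with several output bits: gates in topological order, and the list of output nodes. -/
structure Circuit where
  gates : List Gate
  outputs : List ℕ

/-- The value of a gate, given the values of the earlier nodes. A majority gate is true iff at
least half of its inputs are true. -/
def Gate.value (g : Gate) (vs : List Bool) : Bool :=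
  match g.kind with
  | .and => g.args.all fun a => vs.getD a false
  | .or => g.args.any fun a => vs.getD a false
  | .not => !(vs.getD (g.args.headD 0) false)
  | .maj => decide (g.args.length ≤ 2 * g.args.countP fun a => vs.getD a false)

namespace Circuit

/-- `C` is a circuit on `m` input bits: gates read only inputs and earlier gates, negations have
one input, and the outputs are nodes of the circuit. -/
structure WellFormed (m : ℕ) (C : Circuit) : Prop where
  args_lt : ∀ (i : ℕ) (g : Gate), C.gates[i]? = some g → ∀ a ∈ g.args, a < m + i
  not_unary : ∀ g ∈ C.gates, g.kind = .not → g.args.length = 1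
  outputs_lt : ∀ o ∈ C.outputs, o < m + C.gates.length

/-- The values of all nodes on the input `x`. -/
def nodeValues (C : Circuit) (x : List Bool) : List Bool :=
  C.gates.foldl (fun vs g => vs ++ [g.value vs]) x

/-- The output string of `C` on the input `x`. -/
def output (C : Circuit) (x : List Bool) : List Bool :=
  C.outputs.map fun o => (C.nodeValues x).getD o false

/-- The depths of all nodes of a circuit on `m` input bits; inputs have depth `0`. -/
def nodeDepths (m : ℕ) (C : Circuit) : List ℕ :=
  C.gates.foldl (fun ds g => ds ++ [(g.args.map fun a => ds.getD a 0).foldr max 0 + 1])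
    (List.replicate m 0)

/-- The depth: the largest number of gates on a path (negations are counted). -/
def depth (m : ℕ) (C : Circuit) : ℕ := (C.nodeDepths m).foldr max 0

/-- The size: the number of gates plus the number of wires. -/
def size (C : Circuit) : ℕ := C.gates.length + (C.gates.map fun g => g.args.length).sum

end Circuit

/-! ### Encoding of circuits as strings -/

/-- The alphabet in which circuits are written down. -/
inductive CircuitSymbol
  | tick
  | sep
  | gate (kind : GateKind)
  | out

/-- A node number in unary, followed by a separator. (Node numbers in a circuit of polynomial size
are polynomially bounded, so unary and binary numbering are interchangeable in logarithmic
space.) -/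
def encodeNode (a : ℕ) : List CircuitSymbol := List.replicate a .tick ++ [.sep]

/-- A gate: its type, followed by the nodes that it reads. -/
def Gate.encode (g : Gate) : List CircuitSymbol := .gate g.kind :: g.args.flatMap encodeNode

/-- A circuit on `m` inputs: the number `m`, the gates in their order, the outputs. -/
def Circuit.encode (m : ℕ) (C : Circuit) : List CircuitSymbol :=
  encodeNode m ++ C.gates.flatMap Gate.encode ++ .out :: C.outputs.flatMap encodeNode

/-! ### Deterministic Turing machines with a read-only input tape, work tapes and a write-only
output tape -/

inductive TapeMove
  | left
  | stay
  | right

/-- Head movement on a tape with cells `0, 1, 2, …`; moving left from cell `0` has no effect. -/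
def TapeMove.apply : TapeMove → ℕ → ℕ
  | .left, p => p - 1
  | .stay, p => p
  | .right, p => p + 1

/-- What the input head reads: an end marker or a letter of the input. -/
inductive InputSymbol (α : Type)
  | leftEnd
  | letter (a : α)
  | rightEnd

/-- The input tape for `w`: the left marker in cell `0`, the letters in cells `1, …, |w|`, and the
right marker in cell `|w| + 1`. -/
def readInput {α : Type} (w : List α) : ℕ → InputSymbol α
  | 0 => .leftEnd
  | p + 1 => match w[p]? with
    | some a => .letter a
    | none => .rightEnd

/-- A deterministic Turing transducer with input alphabet `α`, output alphabet `σ`, finitely many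
states, and finitely many work tapes over a finite alphabet. In one step it reads the input cell
and the work cells under its heads; it halts (`none`), or it changes its state, moves the input
head, writes and moves on each work tape, and appends at most one symbol to the output. -/
structure Transducer (α σ : Type) where
  State : Type
  finiteState : Finite State
  Sym : Type
  finiteSym : Finite Sym
  blank : Sym
  tapes : ℕ
  start : State
  step : State → InputSymbol α → (Fin tapes → Sym) →
    Option (State × TapeMove × (Fin tapes → Sym × TapeMove) × Option σ)

namespace Transducer

variable {α σ : Type}

/-- A configuration: state, input head, contents and heads of the work tapes, output so far. -/
structure Config (M : Transducer α σ) where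
  state : M.State
  inputHead : ℕ
  work : Fin M.tapes → ℕ → M.Sym
  head : Fin M.tapes → ℕ
  out : List σ

/-- The start configuration: all work tapes are blank and all heads are in cell `0`. -/
def startConfig (M : Transducer α σ) : M.Config where
  state := M.start
  inputHead := 0
  work := fun _ _ => M.blank
  head := fun _ => 0
  out := []

/-- One step on the input `w`; `none` if the machine halts. The input head cannot leave the cells
`0, …, |w| + 1`. -/
def next (M : Transducer α σ) (w : List α) (c : M.Config) : Option M.Config :=
  match M.step c.state (readInput w c.inputHead) (fun j => c.work j (c.head j)) with
  | none => none
  | some (q, d, act, o) => some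
      { state := q
        inputHead := min (d.apply c.inputHead) (w.length + 1)
        work := fun j => Function.update (c.work j) (c.head j) (act j).1
        head := fun j => (act j).2.apply (c.head j)
        out := c.out ++ o.toList }

/-- On the input `w` the machine halts with output `y`, and throughout the computation it visits
only the first `s` cells of each of its work tapes. -/
def ComputesWithin (M : Transducer α σ) (w : List α) (y : List σ) (s : ℕ) : Prop :=
  (∃ c, StateTransition.Reaches (M.next w) M.startConfig c ∧ M.next w c = none ∧ c.out = y) ∧
  ∀ c, StateTransition.Reaches (M.next w) M.startConfig c → ∀ j, c.head j < s

end Transducer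

/-! ### Logspace uniform `TC⁰` and `AC⁰` -/

/-- Circuit number `m` reads `m` input bits. -/
abbrev CircuitFamily := ℕ → Circuit

namespace CircuitFamily

/-- A deterministic Turing machine computes `1ᵐ ↦ ⟨C m⟩` in space `O(log m)`. -/
def LogspaceUniform (C : CircuitFamily) : Prop :=
  ∃ (M : Transducer Unit CircuitSymbol) (c : ℕ), ∀ m : ℕ,
    M.ComputesWithin (List.replicate m ()) ((C m).encode m) (c * (Nat.log 2 m + 1))

/-- A logspace uniform `TC⁰` circuit family: polynomial size, constant depth, and gates `AND`,
`OR`, `MAJORITY` of unbounded fan-in and `NOT`. -/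
structure IsTC0 (C : CircuitFamily) : Prop where
  wellFormed : ∀ m, (C m).WellFormed m
  polySize : ∃ c : ℕ, ∀ m, (C m).size ≤ m ^ c + c
  constDepth : ∃ d : ℕ, ∀ m, (C m).depth m ≤ d
  uniform : C.LogspaceUniform

/-- A logspace uniform `AC⁰` circuit family: as for `TC⁰`, but without majority gates. -/
structure IsAC0 (C : CircuitFamily) : Prop extends C.IsTC0 where
  noMaj : ∀ m, ∀ g ∈ (C m).gates, g.kind ≠ .maj

end CircuitFamily

/-! ### Nets and net graphs -/

/-- `lines` is the set of lines of a net of order `n` and degree `k` on the point set `P`. -/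
structure IsNet {P : Type} [Fintype P] [DecidableEq P] (n k : ℕ) (lines : Finset (Finset P)) :
    Prop where
  one_le_order : 1 ≤ n
  one_le_degree : 1 ≤ k
  card_points : Fintype.card P = n ^ 2
  card_lines : lines.card = k * n
  card_line : ∀ l ∈ lines, l.card = n
  card_through : ∀ p : P, (lines.filter fun l => p ∈ l).card = k
  parallel : ∃ cls : Finset P → Fin k, ∀ l₁ ∈ lines, ∀ l₂ ∈ lines, l₁ ≠ l₂ →
    (cls l₁ = cls l₂ → Disjoint l₁ l₂) ∧ (cls l₁ ≠ cls l₂ → (l₁ ∩ l₂).card = 1)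

/-- The net graph: distinct points are adjacent iff they lie on a common line. -/
def netGraph {P : Type} (lines : Finset (Finset P)) : SimpleGraph P where
  Adj u v := u ≠ v ∧ ∃ l ∈ lines, u ∈ l ∧ v ∈ l
  symm := ⟨fun _ _ h => ⟨h.1.symm, h.2.imp fun _ hl => ⟨hl.1, hl.2.2, hl.2.1⟩⟩⟩
  loopless := ⟨fun _ h => h.1 rfl⟩

/-! ### Graphs and nets as bit strings -/

/-- A `0/1` matrix written row by row. -/
def matrixBits {N M : ℕ} (B : Fin N → Fin M → Bool) : List Bool :=
  List.ofFn fun i : Fin (N * M) => B i.divNat i.modNat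

open Classical in
/-- The adjacency matrix of a graph, written row by row. -/
noncomputable def graphBits {N : ℕ} (G : SimpleGraph (Fin N)) : List Bool :=
  matrixBits fun u v => decide (G.Adj u v)

/-- The set of points incident with column `j` of a point-block matrix. -/
def column {N M : ℕ} (B : Fin N → Fin M → Bool) (j : Fin M) : Finset (Fin N) :=
  Finset.univ.filter fun p => B p j = true

/-- The column `f l` is the indicator vector of the line `l`, different lines have different
columns, and all columns that belong to no line are zero. -/
def ListsLines {N M : ℕ} (lines : Finset (Finset (Fin N))) (B : Fin N → Fin M → Bool)
    (f : lines ↪ Fin M) : Prop :=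
  (∀ l : lines, column B (f l) = l) ∧ ∀ j, j ∉ Set.range f → column B j = ∅

/-- `B` is the point-block incidence matrix of the net (for some order of its lines), with zero
columns allowed in any places. -/
def IsSparseIncidenceMatrix {N M : ℕ} (lines : Finset (Finset (Fin N)))
    (B : Fin N → Fin M → Bool) : Prop :=
  ∃ f : lines ↪ Fin M, ListsLines lines B f

/-- The first `|lines|` columns of `B` are the point-block incidence matrix of the net (for some
order of its lines), and the remaining columns are zero. -/
def IsIncidenceMatrix {N M : ℕ} (lines : Finset (Finset (Fin N)))
    (B : Fin N → Fin M → Bool) : Prop :=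
  ∃ f : lines ↪ Fin M, ListsLines lines B f ∧ ∀ l : lines, (f l : ℕ) < lines.card

/-! ### The neighbourhood of an edge -/

open Classical in
/-- The vertices `u` and `v` together with their common neighbours. -/
noncomputable def edgeNhd {P : Type} [Fintype P] (G : SimpleGraph P) (u v : P) : Finset P :=
  Finset.univ.filter fun z => z = u ∨ z = v ∨ (G.Adj u z ∧ G.Adj v z)

open Classical in
/-- The number of neighbours of `w` in `S`. -/
noncomputable def degreeIn {P : Type} (G : SimpleGraph P) (S : Finset P) (w : P) : ℕ :=
  (S.filter fun z => G.Adj w z).card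

/-! Geometry. Let `u`, `v` lie on the line `l`, and let `H` consist of `u`, `v` and their common
neighbours. All of `l` lies in `H`, so points of `l` have degree at least `n - 1` there. Let `w` in
`H` be off `l`. At most `k - 1` neighbours of `w` are on `l`, because the lines from `w` to them lie
in different classes, none of them the class of `l`. A point `z` of `H` off `l` is determined by the
classes of `uz` and `vz`, which are distinct and differ from that of `l`; there are at most `(k -
1)(k - 2)` such points, including `w` itself. Hence `w` has degree less than `(k - 1)²`, which is at
most `n - 1`, and the degree in `H` decides membership in `l` (`IsNet.degreeIn_lt`,
`IsNet.mem_line_iff`).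

Queries. Without knowing `n` or `k`, majority gates test `n - 1 ≤ deg` as `n² ≤ (deg + 1)²`: both
sides count pairs of points, and `n²` is the number `N` of vertices. For `k ≤ K` it suffices to
count up to the constant `(K - 1)²`, which existential quantifiers can do. Each line is named by its
first two points. The sparse matrix puts a line into the column numbered by this pair; the full
matrix uses the rank of the pair among all such pairs, again obtained by counting.

Circuits. A query on tuples of vertices is computed by a layer with one gate per tuple. Such layers
give closure under Boolean operations, quantifiers and, with majority, comparison of pair counts
(`Definable`). A formula of fixed shape thus yields constant depth and polynomial size
(`Definable.exists_family`).

Uniformity. A circuit is printed by nested loops up to `m` or `N = √m`. The loop variables are the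
only growing data, and node addresses are written as ticks by further loops instead of being stored
(`Gen`, `TickGen`). A counter language with finitely many registers suffices for this. A transducer
with one work tape interprets it, holding the registers in binary as parallel tracks of `O(log m)`
cells (`Gen.logspace`). -/

/-! ### Good configurations of a transducer -/

namespace Transducer

variable {α σ : Type}

/-- From `c` the machine halts with output `y`, and no reachable configuration has a work head
beyond the first `s` cells. -/
def Good (M : Transducer α σ) (w : List α) (s : ℕ) (y : List σ) (c : M.Config) : Prop :=
  (∃ d, StateTransition.Reaches (M.next w) c d ∧ M.next w d = none ∧ d.out = y) ∧
  ∀ d, StateTransition.Reaches (M.next w) c d → ∀ j, d.head j < s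

theorem Good.of_next {M : Transducer α σ} {w : List α} {s : ℕ} {y : List σ} {c c' : M.Config}
    (h : M.next w c = some c') (hs : ∀ j, c.head j < s) (hc : M.Good w s y c') :
    M.Good w s y c := by
  obtain ⟨⟨d, hd, hn, ho⟩, hb⟩ := hc
  refine ⟨⟨d, Relation.ReflTransGen.head (by simp [h]) hd, hn, ho⟩, fun e he => ?_⟩
  rcases Relation.ReflTransGen.cases_head he with rfl | ⟨f, hf, hfe⟩
  · exact hs
  · rw [h, Option.mem_some] at hf
    subst hf
    exact hb e hfe

theorem Good.of_halted {M : Transducer α σ} {w : List α} {s : ℕ} {y : List σ} {c : M.Config}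
    (h : M.next w c = none) (hs : ∀ j, c.head j < s) (ho : c.out = y) : M.Good w s y c := by
  refine ⟨⟨c, Relation.ReflTransGen.refl, h, ho⟩, fun e he => ?_⟩
  rcases Relation.ReflTransGen.cases_head he with rfl | ⟨f, hf, hfe⟩
  · exact hs
  · simp [h] at hf

end Transducer

/-! ### A language for counter programs, and its interpretation by a one-tape transducer -/

namespace Counter

/-- Programs over registers that hold natural numbers. -/
inductive Cmd (σ : Type)
  | emit (s : σ)
  | inc (r : ℕ)
  | clear (r : ℕ)
  | seq (a b : Cmd σ)
  | ite (r s : ℕ) (a b : Cmd σ)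
  | whileLt (r s : ℕ) (a : Cmd σ)
  | eachLetter (a : Cmd σ)

/-- The phases of the interpreter: `right` and `back` are the two halves of a sweep over the work
tape, with a bit of memory. -/
inductive Phase
  | init
  | ready
  | right (b : Bool)
  | back (b : Bool)
  deriving Fintype

/-- A column of the work tape: one bit of each of the `R` registers. -/
abbrev Col (R : ℕ) := Fin R → Bool

/-- The work alphabet: blank, the marker of the left end, and columns of bits. -/
abbrev Cell (R : ℕ) := Option (Option (Col R))

variable {σ : Type} {R : ℕ}

def Col.bit (c : Col R) (r : ℕ) : Bool := if h : r < R then c ⟨r, h⟩ else false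

def Col.set (c : Col R) (r : ℕ) (b : Bool) : Col R := fun i => if i.val = r then b else c i

/-- The column of the bits number `i` of the registers. -/
def bits (R : ℕ) (ρ : ℕ → ℕ) (i : ℕ) : Col R := fun r => (ρ r).testBit i

namespace Cmd

/-- The memory bit at the start of the sweep that carries out a command. -/
def sweepInit : Cmd σ → Bool
  | inc _ => true
  | _ => false

/-- One step of a sweep. -/
def sweep : Cmd σ → Bool → Col R → Bool × Col R
  | inc r, b, c => (b && c.bit r, c.set r (b ^^ c.bit r))
  | clear r, b, c => (b, c.set r false)
  | ite r s _ _, b, c => (if c.bit r = c.bit s then b else c.bit s, c)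
  | whileLt r s _, b, c => (if c.bit r = c.bit s then b else c.bit s, c)
  | _, b, c => (b, c)

/-- What is written into the first blank cell: a new column if an increment has a carry. -/
def sweepEnd : Cmd σ → Bool → Cell R
  | inc r, true => some (some (Col.set (fun _ => false) r true))
  | _, _ => none

/-- The continuation after a sweep. -/
def dispatch : Cmd σ → Bool → List (Cmd σ) → List (Cmd σ)
  | ite _ _ a _, true, k => a :: k
  | ite _ _ _ b, false, k => b :: k
  | whileLt r s a, true, k => a :: whileLt r s a :: k
  | _, _, k => k

/-- The continuations that occur while `c` is carried out with continuation `k`, except `k`. -/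
def conts : Cmd σ → List (Cmd σ) → Set (List (Cmd σ))
  | seq a b, k => insert (seq a b :: k) (conts a (b :: k) ∪ conts b k)
  | ite r s a b, k => insert (ite r s a b :: k) (conts a k ∪ conts b k)
  | whileLt r s a, k => insert (whileLt r s a :: k) (conts a (whileLt r s a :: k))
  | eachLetter a, k => insert (eachLetter a :: k) (conts a (eachLetter a :: k))
  | c, k => {c :: k}

/-- Finiteness allows continuations to serve as machine states. A loop puts itself back below its
body, so the body always runs with the same continuation and the stack does not grow with the
iterations. -/
theorem finite_conts (c : Cmd σ) (k : List (Cmd σ)) : (c.conts k).Finite := by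
  induction c generalizing k with
  | seq a b iha ihb => exact ((iha _).union (ihb _)).insert _
  | ite r s a b iha ihb => exact ((iha _).union (ihb _)).insert _
  | whileLt r s a ih => exact (ih _).insert _
  | eachLetter a ih => exact (ih _).insert _
  | _ => exact Set.finite_singleton _

theorem mem_conts (c : Cmd σ) (k : List (Cmd σ)) : c :: k ∈ c.conts k := by
  cases c <;> simp [conts]

end Cmd

/-- The instruction table of the interpreter, with lists of commands as states. -/
def table : List (Cmd σ) × Phase → InputSymbol Unit → Cell R →
    Option ((List (Cmd σ) × Phase) × TapeMove × Cell R × TapeMove × Option σ)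
  | (k, .init), _, _ => some ((k, .ready), .stay, some none, .stay, none)
  | ([], _), _, _ => none
  | (.emit s :: k, .ready), _, x => some ((k, .ready), .stay, x, .stay, some s)
  | (.seq a b :: k, .ready), _, x => some ((a :: b :: k, .ready), .stay, x, .stay, none)
  | (.eachLetter a :: k, .ready), .leftEnd, x =>
      some ((.eachLetter a :: k, .ready), .right, x, .stay, none)
  | (.eachLetter a :: k, .ready), .letter _, x =>
      some ((a :: .eachLetter a :: k, .ready), .right, x, .stay, none)
  | (.eachLetter _ :: k, .ready), .rightEnd, x => some ((k, .ready), .stay, x, .stay, none)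
  | (c :: k, .ready), _, x => some ((c :: k, .right c.sweepInit), .stay, x, .right, none)
  | (c :: k, .right b), _, some (some x) =>
      some ((c :: k, .right (c.sweep b x).1), .stay, some (some (c.sweep b x).2), .right, none)
  | (c :: k, .right b), _, _ => some ((c :: k, .back b), .stay, c.sweepEnd b, .left, none)
  | (c :: k, .back b), _, some none =>
      some ((c.dispatch b k, .ready), .stay, some none, .stay, none)
  | (c :: k, .back b), _, x => some ((c :: k, .back b), .stay, x, .left, none)

open Classical in
/-- A list of commands as an element of the finite set `S`, with default value `k₀`. -/
noncomputable def clamp {S : Set (List (Cmd σ))} (k₀ : S) (k : List (Cmd σ)) : S :=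
  if h : k ∈ S then ⟨k, h⟩ else k₀

/-- The interpreter, for programs whose continuations belong to the finite set `S`. -/
noncomputable def machine (R : ℕ) (S : Set (List (Cmd σ))) [Finite S] (k₀ : S) :
    Transducer Unit σ where
  State := S × Phase
  finiteState := inferInstance
  Sym := Cell R
  finiteSym := inferInstance
  blank := none
  tapes := 1
  start := (k₀, .init)
  step q a x := (table (q.1.val, q.2) a (x 0)).map fun z =>
    ((clamp k₀ z.1.1, z.1.2), z.2.1, fun _ => (z.2.2.1, z.2.2.2.1), z.2.2.2.2)

/-! ### Correctness of the interpreter, command by command -/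

section Interpreter

variable {S : Set (List (Cmd σ))} [Finite S] {k₀ : S} {w : List Unit} {B : ℕ}

/-- A configuration of the interpreter. -/
noncomputable def conf (k₀ : S) (k : List (Cmd σ)) (p : Phase) (T : ℕ → Cell R) (h i : ℕ)
    (out : List σ) : (machine R S k₀).Config where
  state := (clamp k₀ k, p)
  inputHead := i
  work := fun _ => T
  head := fun _ => h
  out := out

theorem next_conf {k : List (Cmd σ)} (hk : k ∈ S) (p : Phase) (T : ℕ → Cell R) (h i : ℕ)
    (out : List σ) : (machine R S k₀).next w (conf k₀ k p T h i out) =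
      (table (k, p) (readInput w i) (T h)).map fun z =>
        conf k₀ z.1.1 z.1.2 (Function.update T h z.2.2.1) (z.2.2.2.1.apply h)
          (min (z.2.1.apply i) (w.length + 1)) (out ++ z.2.2.2.2.toList) := by
  have hc : (clamp k₀ k).val = k := by simp [clamp, hk]
  simp only [Transducer.next, machine, conf, hc]
  cases table (k, p) (readInput w i) (T h) <;> rfl

theorem good_conf {k : List (Cmd σ)} (hk : k ∈ S) {p : Phase} {T : ℕ → Cell R} {h i : ℕ}
    {out y : List σ} {q : List (Cmd σ) × Phase} {d : TapeMove} {x : Cell R} {d' : TapeMove}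
    {o : Option σ} (ht : table (k, p) (readInput w i) (T h) = some (q, d, x, d', o))
    (hB : h < B + 2)
    (hg : (machine R S k₀).Good w (B + 2) y (conf k₀ q.1 q.2 (Function.update T h x)
      (d'.apply h) (min (d.apply i) (w.length + 1)) (out ++ o.toList))) :
    (machine R S k₀).Good w (B + 2) y (conf k₀ k p T h i out) :=
  Transducer.Good.of_next (by rw [next_conf hk, ht]; rfl) (fun _ => hB) hg

/-- The tape `T` holds the registers `ρ`, in at most `B` columns. -/
def Holds (B : ℕ) (ρ : ℕ → ℕ) (T : ℕ → Cell R) : Prop :=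
  ∃ L ≤ B, T 0 = some none ∧ (∀ i < L, T (i + 1) = some (some (bits R ρ i))) ∧
    (∀ i, L ≤ i → T (i + 1) = none) ∧ ∀ r < R, ρ r < 2 ^ L

/-- With the registers `ρ` on the tape, the interpreter is about to carry out `k`, and it will
produce the output `y`. -/
def Ready (R : ℕ) (w : List Unit) (B : ℕ) (k₀ : S) (k : List (Cmd σ)) (ρ : ℕ → ℕ) (i : ℕ)
    (out y : List σ) : Prop :=
  ∀ T, Holds (R := R) B ρ T → (machine R S k₀).Good w (B + 2) y (conf k₀ k .ready T 0 i out)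

theorem good_back {c : Cmd σ} {k : List (Cmd σ)} (hk : c :: k ∈ S) {b : Bool} {T : ℕ → Cell R}
    {h i : ℕ} {out y : List σ} (hi : i ≤ w.length + 1) (hB : h < B + 2) (h0 : T 0 = some none)
    (hT : ∀ j, T (j + 1) ≠ some none)
    (hg : (machine R S k₀).Good w (B + 2) y (conf k₀ (c.dispatch b k) .ready T 0 i out)) :
    (machine R S k₀).Good w (B + 2) y (conf k₀ (c :: k) (.back b) T h i out) := by
  induction h with
  | zero =>
    refine good_conf hk (q := (c.dispatch b k, .ready)) (d := .stay) (x := some none)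
      (d' := .stay) (o := none) (by rw [h0]; rfl) hB ?_
    rw [← h0, Function.update_eq_self]
    simpa [TapeMove.apply, hi] using hg
  | succ h ih =>
    refine good_conf hk (q := (c :: k, .back b)) (d := .stay) (x := T (h + 1))
      (d' := .left) (o := none) ?_ hB ?_
    · have := hT h
      rcases hx : T (h + 1) with _ | _ | x
      · rfl
      · exact absurd hx this
      · rfl
    · rw [Function.update_eq_self]
      simpa [TapeMove.apply, hi] using ih (by omega)

/-- Invariant of the sweep to the right: columns before `j` already hold `ρ'`, the others still hold
`ρ`, and `fl j` is the memory bit on arrival at column `j`. The induction is on the number of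
columns left. -/
theorem good_right {c : Cmd σ} {k : List (Cmd σ)} (hk : c :: k ∈ S) {ρ ρ' : ℕ → ℕ}
    {fl : ℕ → Bool} {L : ℕ} {i : ℕ} {out y : List σ} (hi : i ≤ w.length + 1) (hL : L ≤ B)
    (hfl : ∀ j < L, c.sweep (fl j) (bits R ρ j) = (fl (j + 1), bits R ρ' j))
    (hg : ∀ T : ℕ → Cell R, T 0 = some none → (∀ j < L, T (j + 1) = some (some (bits R ρ' j))) →
      T (L + 1) = c.sweepEnd (fl L) → (∀ j, L < j → T (j + 1) = none) →
      (machine R S k₀).Good w (B + 2) y (conf k₀ (c :: k) (.back (fl L)) T L i out))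
    {j : ℕ} (hj : j ≤ L) {T : ℕ → Cell R} (h0 : T 0 = some none)
    (hlo : ∀ j' < j, T (j' + 1) = some (some (bits R ρ' j')))
    (hmid : ∀ j', j ≤ j' → j' < L → T (j' + 1) = some (some (bits R ρ j')))
    (hhi : ∀ j', L ≤ j' → T (j' + 1) = none) :
    (machine R S k₀).Good w (B + 2) y (conf k₀ (c :: k) (.right (fl j)) T (j + 1) i out) := by
  obtain ⟨e, he⟩ : ∃ e, L = j + e := ⟨L - j, by omega⟩
  induction e generalizing j T with
  | zero =>
    obtain rfl : L = j := by omega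
    refine good_conf hk (q := (c :: k, .back (fl L))) (d := .stay) (x := c.sweepEnd (fl L))
      (d' := .left) (o := none) (by rw [hhi L (by omega)]; rfl) (by omega) ?_
    have := hg (Function.update T (L + 1) (c.sweepEnd (fl L))) (by simp [h0])
      (fun a ha => by
        rw [Function.update_of_ne (by omega)]
        exact hlo a (by omega))
      (by simp)
      (fun a ha => by
        rw [Function.update_of_ne (by omega)]
        exact hhi a (by omega))
    simpa [TapeMove.apply, hi] using this
  | succ e ih =>
    have hf := hfl j (by omega)
    refine good_conf hk (q := (c :: k, .right (fl (j + 1)))) (d := .stay)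
      (x := some (some (bits R ρ' j))) (d' := .right) (o := none)
      (by rw [hmid j le_rfl (by omega)]; simp only [table, hf]) (by omega) ?_
    have := @ih (j + 1) (by omega) (Function.update T (j + 1) (some (some (bits R ρ' j))))
      (by simp [h0])
      (fun a ha => by
        rcases eq_or_ne a j with rfl | hne
        · simp
        · rw [Function.update_of_ne (by omega)]
          exact hlo a (by omega))
      (fun a ha ha' => by
        rw [Function.update_of_ne (by omega)]
        exact hmid a (by omega) (by omega))
      (fun a ha => by
        rw [Function.update_of_ne (by omega)]
        exact hhi a (by omega)) (by omega)
    simpa [TapeMove.apply, hi] using this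

/-- The commands that are carried out by a sweep. -/
def Cmd.IsSweep : Cmd σ → Prop
  | .inc _ | .clear _ | .ite _ _ _ _ | .whileLt _ _ _ => True
  | _ => False

/-- The number `L` of columns in use is hidden in `Holds`, so `hend` has to cover every `L` into
which the registers fit. Its two alternatives are a sweep that leaves the length unchanged and one
that appends a column. -/
theorem Ready.sweep {c : Cmd σ} (hc : c.IsSweep) {k : List (Cmd σ)} (hk : c :: k ∈ S)
    {ρ ρ' : ℕ → ℕ} {fl : ℕ → Bool} {b : Bool} {i : ℕ} {out y : List σ} (hi : i ≤ w.length + 1)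
    (h0 : fl 0 = c.sweepInit)
    (hfl : ∀ j, c.sweep (fl j) (bits R ρ j) = (fl (j + 1), bits R ρ' j))
    (hend : ∀ L, (∀ r < R, ρ r < 2 ^ L) →
      c.dispatch (fl L) = c.dispatch b ∧
      (c.sweepEnd (R := R) (fl L) = none ∧ (∀ r < R, ρ' r < 2 ^ L) ∨
        c.sweepEnd (R := R) (fl L) = some (some (bits R ρ' L)) ∧ L + 1 ≤ B ∧
          ∀ r < R, ρ' r < 2 ^ (L + 1)))
    (hg : Ready R w B k₀ (c.dispatch b k) ρ' i out y) : Ready R w B k₀ (c :: k) ρ i out y := by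
  rintro T ⟨L, hLB, hm, hlo, hhi, hρ⟩
  obtain ⟨hd, he⟩ := hend L hρ
  have ht : table (c :: k, .ready) (readInput w i) (T 0) =
      some ((c :: k, .right (fl 0)), .stay, T 0, .right, none) := by
    rw [h0]
    cases c <;> first | rfl | exact hc.elim
  refine good_conf hk ht (by omega) ?_
  rw [Function.update_eq_self]
  have := good_right (k₀ := k₀) (w := w) (B := B) (R := R) (T := T) (y := y) (out := out)
    (j := 0) hk hi hLB (fun j _ => hfl j) ?_ (Nat.zero_le _) hm (by simp)
    (fun j _ h => hlo j h) hhi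
  · simpa [TapeMove.apply, hi] using this
  · intro T' h0' hlo' hL' hhi'
    refine good_back hk hi (by omega) h0' (fun j => ?_) ?_
    · rcases lt_trichotomy j L with h | rfl | h
      · simp [hlo' j h]
      · rcases he with ⟨h, -⟩ | ⟨h, -⟩ <;> simp [hL', h]
      · simp [hhi' j h]
    · rw [hd]
      refine hg T' ?_
      rcases he with ⟨h, hb⟩ | ⟨h, hB, hb⟩
      · refine ⟨L, hLB, h0', hlo', fun j hj => ?_, hb⟩
        rcases hj.eq_or_lt with rfl | hj
        · rw [hL', h]
        · exact hhi' j hj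
      · refine ⟨L + 1, hB, h0', fun j hj => ?_, fun j hj => hhi' j (by omega), hb⟩
        rcases (Nat.lt_succ_iff.1 hj).eq_or_lt with rfl | hj
        · rw [hL', h]
        · exact hlo' j hj

theorem Col.bit_bits (ρ : ℕ → ℕ) (i : ℕ) {r : ℕ} (hr : r < R) :
    (bits R ρ i).bit r = (ρ r).testBit i := by
  simp [Col.bit, bits, hr]

theorem Col.set_bits (ρ : ℕ → ℕ) (i r v : ℕ) :
    (bits R ρ i).set r (v.testBit i) = bits R (Function.update ρ r v) i := by
  funext j
  by_cases h : j.val = r <;> simp [Col.set, bits, h]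

/-- There is a carry into bit `j` exactly when adding one raises the quotient by `2 ^ j`; this is
the flag `fl`. A carry leaves the last of `L` columns only if `ρ r + 1 = 2 ^ L`, and then `hρ` gives
`L < B`, so there is room for the new column. -/
theorem Ready.inc {r : ℕ} (hr : r < R) {k : List (Cmd σ)} (hk : .inc r :: k ∈ S) {ρ : ℕ → ℕ}
    {i : ℕ} {out y : List σ} (hi : i ≤ w.length + 1) (hρ : ρ r + 1 < 2 ^ B)
    (hg : Ready R w B k₀ k (Function.update ρ r (ρ r + 1)) i out y) :
    Ready R w B k₀ (.inc r :: k) ρ i out y := by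
  refine Ready.sweep (c := .inc r) trivial hk (ρ' := Function.update ρ r (ρ r + 1))
    (fl := fun j => decide ((ρ r + 1) / 2 ^ j = ρ r / 2 ^ j + 1)) (b := true) hi ?_ ?_ ?_ hg
  · simp [Cmd.sweepInit]
  · intro j
    have key : ∀ n : ℕ, (n.testBit j) = decide (n / 2 ^ j % 2 = 1) := fun n => by
      rw [Nat.testBit_eq_decide_div_mod_eq]
    have h1 : (ρ r + 1) / 2 ^ j = ρ r / 2 ^ j + 1 ∨ (ρ r + 1) / 2 ^ j = ρ r / 2 ^ j := by
      rw [Nat.succ_div]; split_ifs <;> simp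
    have h2 : ∀ n : ℕ, n / 2 ^ (j + 1) = n / 2 ^ j / 2 := fun n => by
      rw [pow_succ, Nat.div_div_eq_div_mul]
    simp only [Cmd.sweep, Col.bit_bits _ _ hr, ← Col.set_bits, Prod.mk.injEq]
    rw [h2, h2, key, key]
    constructor
    · rw [Bool.eq_iff_iff]
      simp only [Bool.and_eq_true, decide_eq_true_eq]
      omega
    · congr 1
      rw [Bool.eq_iff_iff]
      simp only [bne_iff_ne, ne_eq, decide_eq_true_eq]
      rcases h1 with h1 | h1 <;> rw [h1] <;> simp; omega
  · intro L hL
    refine ⟨rfl, ?_⟩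
    have hlt := hL r hr
    have h0 : ρ r / 2 ^ L = 0 := Nat.div_eq_of_lt hlt
    simp only [h0]
    by_cases h : ρ r + 1 = 2 ^ L
    · right
      rw [h]
      refine ⟨?_, ?_, ?_⟩
      · simp only [Nat.div_self (Nat.two_pow_pos L), decide_true, Cmd.sweepEnd]
        congr 2
        rw [← Col.set_bits, Nat.testBit_two_pow_self]
        congr 1
        funext s
        simp [bits, Nat.testBit_lt_two_pow (hL s s.2)]
      · rw [h] at hρ
        exact (Nat.pow_lt_pow_iff_right (by norm_num)).1 hρ
      · intro s hs
        rcases eq_or_ne s r with rfl | hne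
        · simp [pow_succ]
        · rw [Function.update_of_ne hne, pow_succ]
          have := hL s hs
          omega
    · left
      have h' : ρ r + 1 < 2 ^ L := by omega
      rw [Nat.div_eq_of_lt h']
      refine ⟨rfl, fun s hs => ?_⟩
      rcases eq_or_ne s r with rfl | hne
      · simpa using h'
      · rw [Function.update_of_ne hne]
        exact hL s hs

theorem Ready.clear {r : ℕ} {k : List (Cmd σ)} (hk : .clear r :: k ∈ S) {ρ : ℕ → ℕ}
    {i : ℕ} {out y : List σ} (hi : i ≤ w.length + 1)
    (hg : Ready R w B k₀ k (Function.update ρ r 0) i out y) :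
    Ready R w B k₀ (.clear r :: k) ρ i out y := by
  refine Ready.sweep (c := .clear r) trivial hk (ρ' := Function.update ρ r 0)
    (fl := fun j => false) (b := true) hi rfl ?_ ?_ hg
  · intro j
    simp [Cmd.sweep, ← Col.set_bits]
  · intro L hL
    refine ⟨rfl, Or.inl ⟨rfl, fun s hs => ?_⟩⟩
    rcases eq_or_ne s r with rfl | hne
    · simp
    · rw [Function.update_of_ne hne]
      exact hL s hs

/-- Bits are read from the least significant one upwards, so each position where the numbers differ
overrides the verdict on the lower bits; there the bit of `b` tells which number is larger. -/
theorem sweep_lt (a b j : ℕ) : (if a.testBit j = b.testBit j then decide (a % 2 ^ j < b % 2 ^ j)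
    else b.testBit j) = decide (a % 2 ^ (j + 1) < b % 2 ^ (j + 1)) := by
  have h1 := Nat.mod_lt a (Nat.two_pow_pos j)
  have h2 := Nat.mod_lt b (Nat.two_pow_pos j)
  rw [Nat.testBit_eq_decide_div_mod_eq, Nat.testBit_eq_decide_div_mod_eq, Nat.mod_pow_succ,
    Nat.mod_pow_succ]
  rcases Nat.mod_two_eq_zero_or_one (a / 2 ^ j) with ha | ha <;>
  rcases Nat.mod_two_eq_zero_or_one (b / 2 ^ j) with hb | hb <;> simp [ha, hb] <;> omega

theorem Ready.ite {r s : ℕ} (hr : r < R) (hs : s < R) {a b : Cmd σ} {k : List (Cmd σ)}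
    (hk : .ite r s a b :: k ∈ S) {ρ : ℕ → ℕ} {i : ℕ} {out y : List σ} (hi : i ≤ w.length + 1)
    (hg : Ready R w B k₀ ((if ρ r < ρ s then a else b) :: k) ρ i out y) :
    Ready R w B k₀ (.ite r s a b :: k) ρ i out y := by
  refine Ready.sweep (c := .ite r s a b) trivial hk (ρ' := ρ)
    (fl := fun j => decide (ρ r % 2 ^ j < ρ s % 2 ^ j)) (b := decide (ρ r < ρ s)) hi ?_ ?_ ?_ ?_
  · simp [Cmd.sweepInit, Nat.mod_one]
  · intro j
    simp [Cmd.sweep, Col.bit_bits _ _ hr, Col.bit_bits _ _ hs, sweep_lt]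
  · intro L hL
    refine ⟨?_, Or.inl ⟨rfl, hL⟩⟩
    rw [Nat.mod_eq_of_lt (hL r hr), Nat.mod_eq_of_lt (hL s hs)]
  · by_cases h : ρ r < ρ s <;> simpa [h, Cmd.dispatch] using hg

theorem Ready.whileLt {r s : ℕ} (hr : r < R) (hs : s < R) {a : Cmd σ} {k : List (Cmd σ)}
    (hk : .whileLt r s a :: k ∈ S) {ρ : ℕ → ℕ} {i : ℕ} {out y : List σ} (hi : i ≤ w.length + 1)
    (hg : Ready R w B k₀ (if ρ r < ρ s then a :: .whileLt r s a :: k else k) ρ i out y) :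
    Ready R w B k₀ (.whileLt r s a :: k) ρ i out y := by
  refine Ready.sweep (c := .whileLt r s a) trivial hk (ρ' := ρ)
    (fl := fun j => decide (ρ r % 2 ^ j < ρ s % 2 ^ j)) (b := decide (ρ r < ρ s)) hi ?_ ?_ ?_ ?_
  · simp [Cmd.sweepInit, Nat.mod_one]
  · intro j
    simp [Cmd.sweep, Col.bit_bits _ _ hr, Col.bit_bits _ _ hs, sweep_lt]
  · intro L hL
    refine ⟨?_, Or.inl ⟨rfl, hL⟩⟩
    rw [Nat.mod_eq_of_lt (hL r hr), Nat.mod_eq_of_lt (hL s hs)]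
  · by_cases h : ρ r < ρ s <;> simpa [h, Cmd.dispatch] using hg

theorem Ready.emit {s : σ} {k : List (Cmd σ)} (hk : .emit s :: k ∈ S) {ρ : ℕ → ℕ} {i : ℕ}
    {out y : List σ} (hi : i ≤ w.length + 1) (hg : Ready R w B k₀ k ρ i (out ++ [s]) y) :
    Ready R w B k₀ (.emit s :: k) ρ i out y := by
  intro T hT
  refine good_conf hk (q := (k, .ready)) (d := .stay) (x := T 0) (d' := .stay) (o := some s)
    rfl (by omega) ?_
  rw [Function.update_eq_self]
  simpa [TapeMove.apply, hi] using hg T hT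

theorem Ready.seq {a b : Cmd σ} {k : List (Cmd σ)} (hk : .seq a b :: k ∈ S) {ρ : ℕ → ℕ} {i : ℕ}
    {out y : List σ} (hi : i ≤ w.length + 1) (hg : Ready R w B k₀ (a :: b :: k) ρ i out y) :
    Ready R w B k₀ (.seq a b :: k) ρ i out y := by
  intro T hT
  refine good_conf hk (q := (a :: b :: k, .ready)) (d := .stay) (x := T 0) (d' := .stay)
    (o := none) rfl (by omega) ?_
  rw [Function.update_eq_self]
  simpa [TapeMove.apply, hi] using hg T hT

/-- The loop over the letters, with the input head on letter number `i`. -/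
theorem Ready.eachLetter_letter {a : Cmd σ} {k : List (Cmd σ)} (hk : .eachLetter a :: k ∈ S)
    {ρ : ℕ → ℕ} {i : ℕ} {out y : List σ} (hi : i < w.length)
    (hg : Ready R w B k₀ (a :: .eachLetter a :: k) ρ (i + 2) out y) :
    Ready R w B k₀ (.eachLetter a :: k) ρ (i + 1) out y := by
  intro T hT
  refine good_conf hk (q := (a :: .eachLetter a :: k, .ready)) (d := .right) (x := T 0)
    (d' := .stay) (o := none) (by simp [readInput, hi, table]) (by omega) ?_
  rw [Function.update_eq_self]
  simpa [TapeMove.apply, hi] using hg T hT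

theorem Ready.eachLetter_leftEnd {a : Cmd σ} {k : List (Cmd σ)} (hk : .eachLetter a :: k ∈ S)
    {ρ : ℕ → ℕ} {out y : List σ}
    (hg : Ready R w B k₀ (.eachLetter a :: k) ρ 1 out y) :
    Ready R w B k₀ (.eachLetter a :: k) ρ 0 out y := by
  intro T hT
  refine good_conf hk (q := (.eachLetter a :: k, .ready)) (d := .right) (x := T 0)
    (d' := .stay) (o := none) (by simp [readInput, table]) (by omega) ?_
  rw [Function.update_eq_self]
  simpa [TapeMove.apply] using hg T hT

theorem Ready.eachLetter_rightEnd {a : Cmd σ} {k : List (Cmd σ)} (hk : .eachLetter a :: k ∈ S)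
    {ρ : ℕ → ℕ} {out y : List σ}
    (hg : Ready R w B k₀ k ρ (w.length + 1) out y) :
    Ready R w B k₀ (.eachLetter a :: k) ρ (w.length + 1) out y := by
  intro T hT
  refine good_conf hk (q := (k, .ready)) (d := .stay) (x := T 0)
    (d' := .stay) (o := none) (by simp [readInput, table]) (by omega) ?_
  rw [Function.update_eq_self]
  simpa [TapeMove.apply] using hg T hT

end Interpreter

end Counter

/-! ### Composable specifications of counter programs -/

namespace Counter

variable {σ : Type}

/-- The command `c` changes the registers `ρ` into `ρ'`, moves the input head from `i` to `i'` and
emits `o`. -/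
def Runs (R : ℕ) (w : List Unit) (B : ℕ) (c : Cmd σ) (ρ : ℕ → ℕ) (i : ℕ) (o : List σ)
    (ρ' : ℕ → ℕ) (i' : ℕ) : Prop :=
  ∀ (S : Set (List (Cmd σ))) [Finite S] (k₀ : S) (k : List (Cmd σ)), c.conts k ⊆ S → k ∈ S →
    ∀ out y, Ready R w B k₀ k ρ' i' (out ++ o) y → Ready R w B k₀ (c :: k) ρ i out y

section Runs

variable {R : ℕ} {w : List Unit} {B : ℕ} {ρ ρ' ρ'' : ℕ → ℕ} {i i' i'' : ℕ}

theorem Runs.emit (s : σ) (hi : i ≤ w.length + 1) : Runs R w B (.emit s) ρ i [s] ρ i :=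
  fun _ _ _ _ hS _ _ _ h => Ready.emit (hS (Cmd.mem_conts _ _)) hi h

theorem Runs.inc {r : ℕ} (hr : r < R) (hi : i ≤ w.length + 1) (hρ : ρ r + 1 < 2 ^ B) :
    Runs (σ := σ) R w B (.inc r) ρ i [] (Function.update ρ r (ρ r + 1)) i :=
  fun _ _ _ _ hS _ _ _ h => Ready.inc hr (hS (Cmd.mem_conts _ _)) hi hρ (by simpa using h)

theorem Runs.clear (r : ℕ) (hi : i ≤ w.length + 1) :
    Runs (σ := σ) R w B (.clear r) ρ i [] (Function.update ρ r 0) i :=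
  fun _ _ _ _ hS _ _ _ h => Ready.clear (hS (Cmd.mem_conts _ _)) hi (by simpa using h)

theorem Runs.seq {a b : Cmd σ} {o o' : List σ} (hi : i ≤ w.length + 1)
    (ha : Runs R w B a ρ i o ρ' i') (hb : Runs R w B b ρ' i' o' ρ'' i'') :
    Runs R w B (.seq a b) ρ i (o ++ o') ρ'' i'' := by
  intro S _ k₀ k hS hk out y h
  have ha' : a.conts (b :: k) ⊆ S := fun x hx => hS (Or.inr (Or.inl hx))
  have hb' : b.conts k ⊆ S := fun x hx => hS (Or.inr (Or.inr hx))
  refine Ready.seq (hS (Cmd.mem_conts _ _)) hi ?_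
  exact ha S k₀ _ ha' (hb' (Cmd.mem_conts _ _)) _ _ (hb S k₀ _ hb' hk _ _ (by simpa using h))

theorem Runs.ite {r s : ℕ} (hr : r < R) (hs : s < R) {a b : Cmd σ} {o : List σ}
    (hi : i ≤ w.length + 1) (h : Runs R w B (if ρ r < ρ s then a else b) ρ i o ρ' i') :
    Runs R w B (.ite r s a b) ρ i o ρ' i' := by
  intro S _ k₀ k hS hk out y hg
  refine Ready.ite hr hs (hS (Cmd.mem_conts _ _)) hi (h S k₀ k ?_ hk out y hg)
  split_ifs
  · exact fun x hx => hS (Or.inr (Or.inl hx))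
  · exact fun x hx => hS (Or.inr (Or.inr hx))

theorem Runs.whileLt_of_lt {r s : ℕ} (hr : r < R) (hs : s < R) {a : Cmd σ} {o o' : List σ}
    (hi : i ≤ w.length + 1) (hlt : ρ r < ρ s) (ha : Runs R w B a ρ i o ρ' i')
    (h : Runs R w B (.whileLt r s a) ρ' i' o' ρ'' i'') :
    Runs R w B (.whileLt r s a) ρ i (o ++ o') ρ'' i'' := by
  intro S _ k₀ k hS hk out y hg
  refine Ready.whileLt hr hs (hS (Cmd.mem_conts _ _)) hi ?_
  rw [if_pos hlt]
  exact ha S k₀ _ (fun x hx => hS (Or.inr hx)) (hS (Cmd.mem_conts _ _)) _ _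
    (h S k₀ k hS hk _ _ (by simpa using hg))

theorem Runs.whileLt_of_not_lt {r s : ℕ} (hr : r < R) (hs : s < R) {a : Cmd σ}
    (hi : i ≤ w.length + 1) (hlt : ¬ ρ r < ρ s) : Runs R w B (.whileLt r s a) ρ i [] ρ i := by
  intro S _ k₀ k hS hk out y hg
  refine Ready.whileLt hr hs (hS (Cmd.mem_conts _ _)) hi ?_
  rw [if_neg hlt]
  simpa using hg

end Runs

/-! ### Strings that can be generated -/

/-- The registers `ρ` hold `m`, `N`, and the list `t` in the places `loc`. -/
structure Env (d : ℕ) (loc : ℕ → ℕ) (m N : ℕ) (t : List ℕ) (ρ : ℕ → ℕ) : Prop where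
  length : t.length = d
  m_eq : ρ 0 = m
  N_eq : ρ 1 = N
  loc_eq : ∀ k < d, ρ (loc k) = t.getD k 0

/-- The string `f m N t` is emitted by a program that finds `m` and `N` in the registers `0` and
`1` and the list `t` of length `d` in any registers, and leaves these registers unchanged. -/
def Gen (d : ℕ) (f : ℕ → ℕ → List ℕ → List σ) : Prop :=
  ∀ (loc : ℕ → ℕ) (s : ℕ), 2 ≤ s → (∀ k < d, loc k < s) → ∃ (c : Cmd σ) (R₀ : ℕ), ∀ R ≥ R₀,
    ∀ (w : List Unit) (B i m N : ℕ) (t : List ℕ) (ρ : ℕ → ℕ), i ≤ w.length + 1 →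
      Env d loc m N t ρ → (∀ r, ρ r < 2 ^ B) →
      ∃ ρ' : ℕ → ℕ, (∀ r < s, ρ' r = ρ r) ∧ (∀ r, ρ' r < 2 ^ B) ∧
        Runs R w B c ρ i (f m N t) ρ' i

/-- The number `b m N t` is one of `m`, `N` and the entries of `t`. -/
def IsReg (d : ℕ) (b : ℕ → ℕ → List ℕ → ℕ) : Prop :=
  ∀ (loc : ℕ → ℕ) (s : ℕ), 2 ≤ s → (∀ k < d, loc k < s) →
    ∃ r < s, ∀ m N t ρ, Env d loc m N t ρ → ρ r = b m N t

theorem isReg_m (d : ℕ) : IsReg d (fun m _ _ => m) :=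
  fun _ _ hs _ => ⟨0, by omega, fun _ _ _ _ h => h.m_eq⟩

theorem isReg_N (d : ℕ) : IsReg d (fun _ N _ => N) :=
  fun _ _ hs _ => ⟨1, by omega, fun _ _ _ _ h => h.N_eq⟩

theorem isReg_getD {d k : ℕ} (hk : k < d) : IsReg d (fun _ _ t => t.getD k 0) :=
  fun loc _ _ hl => ⟨loc k, hl k hk, fun _ _ _ _ h => h.loc_eq k hk⟩

/-! ### Closure properties of generated strings -/

namespace Gen

variable {d : ℕ} {f g : ℕ → ℕ → List ℕ → List σ}

theorem congr (hf : Gen d f) (h : ∀ m N t, t.length = d → g m N t = f m N t) : Gen d g := by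
  intro loc s hs hl
  obtain ⟨c, R₀, hc⟩ := hf loc s hs hl
  refine ⟨c, R₀, fun R hR w B i m N t ρ hi he hρ => ?_⟩
  rw [h m N t he.length]
  exact hc R hR w B i m N t ρ hi he hρ

theorem nil (d : ℕ) : Gen d (fun _ _ _ => ([] : List σ)) := by
  intro loc s hs hl
  -- The language has no empty command; clearing the scratch register `s` replaces it, since only
  -- registers below `s` must be preserved.
  refine ⟨.clear s, 0, fun R hR w B i m N t ρ hi he hρ => ?_⟩
  refine ⟨_, fun r hr => ?_, fun r => ?_, Runs.clear s hi⟩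
  · rw [Function.update_of_ne hr.ne]
  · rcases eq_or_ne r s with rfl | h
    · simp
    · rw [Function.update_of_ne h]
      exact hρ r

theorem emit (d : ℕ) (a : σ) : Gen d (fun _ _ _ => [a]) :=
  fun _ _ _ _ => ⟨.emit a, 0, fun _ _ _ _ _ _ _ _ ρ hi _ hρ =>
    ⟨ρ, fun _ _ => rfl, hρ, Runs.emit a hi⟩⟩

theorem append (hf : Gen d f) (hg : Gen d g) : Gen d (fun m N t => f m N t ++ g m N t) := by
  intro loc s hs hl
  obtain ⟨c, R₀, hc⟩ := hf loc s hs hl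
  obtain ⟨c', R₁, hc'⟩ := hg loc s hs hl
  refine ⟨.seq c c', max R₀ R₁, fun R hR w B i m N t ρ hi he hρ => ?_⟩
  obtain ⟨ρ₁, h1, hb1, hr1⟩ := hc R (le_trans (le_max_left _ _) hR) w B i m N t ρ hi he hρ
  have he1 : Env d loc m N t ρ₁ := ⟨he.length, by rw [h1 0 (by omega), he.m_eq],
    by rw [h1 1 (by omega), he.N_eq], fun k hk => by rw [h1 _ (hl k hk), he.loc_eq k hk]⟩
  obtain ⟨ρ₂, h2, hb2, hr2⟩ := hc' R (le_trans (le_max_right _ _) hR) w B i m N t ρ₁ hi he1 hb1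
  exact ⟨ρ₂, fun r hr => by rw [h2 r hr, h1 r hr], hb2, Runs.seq hi hr1 hr2⟩

theorem cons (a : σ) (hf : Gen d f) : Gen d (fun m N t => a :: f m N t) :=
  (emit d a).append hf

/-- `Gen` quantifies over all placements `loc` of the list, so rearranging or dropping entries only
redirects the program to other registers. -/
theorem rename (hf : Gen d f) {d' : ℕ} (τ : List ℕ) (hd : τ.length = d) (hτ : ∀ j ∈ τ, j < d') :
    Gen d' (fun m N t => f m N (τ.map fun j => t.getD j 0)) := by
  intro loc s hs hl
  have hmem : ∀ k < d, τ.getD k 0 ∈ τ := fun k hk => by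
    rw [List.getD_eq_getElem _ _ (by omega)]
    exact List.getElem_mem _
  obtain ⟨c, R₀, hc⟩ := hf (fun k => loc (τ.getD k 0)) s hs
    (fun k hk => hl _ (hτ _ (hmem k hk)))
  refine ⟨c, R₀, fun R hR w B i m N t ρ hi he hρ => hc R hR w B i m N _ ρ hi ?_ hρ⟩
  refine ⟨by simpa using hd, he.m_eq, he.N_eq, fun k hk => ?_⟩
  have hk' : k < τ.length := by omega
  rw [he.loc_eq _ (hτ _ (hmem k hk))]
  simp [List.getD, hk']

theorem ite {b b' : ℕ → ℕ → List ℕ → ℕ} (hb : IsReg d b) (hb' : IsReg d b') (hf : Gen d f)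
    (hg : Gen d g) : Gen d (fun m N t => if b m N t < b' m N t then f m N t else g m N t) := by
  intro loc s hs hl
  obtain ⟨c, R₀, hc⟩ := hf loc s hs hl
  obtain ⟨c', R₁, hc'⟩ := hg loc s hs hl
  obtain ⟨r, hr, hrb⟩ := hb loc s hs hl
  obtain ⟨r', hr', hrb'⟩ := hb' loc s hs hl
  refine ⟨.ite r r' c c', max s (max R₀ R₁), fun R hR w B i m N t ρ hi he hρ => ?_⟩
  have hR' := max_le_iff.1 hR
  have hR'' := max_le_iff.1 hR'.2
  beta_reduce
  rw [← hrb _ _ _ _ he, ← hrb' _ _ _ _ he]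
  by_cases h : ρ r < ρ r'
  · obtain ⟨ρ₁, h1, hb1, hr1⟩ := hc R hR''.1 w B i m N t ρ hi he hρ
    refine ⟨ρ₁, h1, hb1, Runs.ite (by omega) (by omega) hi ?_⟩
    simpa [h] using hr1
  · obtain ⟨ρ₁, h1, hb1, hr1⟩ := hc' R hR''.2 w B i m N t ρ hi he hρ
    refine ⟨ρ₁, h1, hb1, Runs.ite (by omega) (by omega) hi ?_⟩
    simpa [h] using hr1

/-- The loop variable occupies the scratch register `s`, and the body is generated with scratch
space from `s + 1` on. Nested loops therefore do not interfere, and the register with the loop bound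
survives the body. -/
theorem flatMap {b : ℕ → ℕ → List ℕ → ℕ} (hb : IsReg d b) (hf : Gen (d + 1) f) :
    Gen d (fun m N t => (List.range (b m N t)).flatMap fun x => f m N (x :: t)) := by
  intro loc s hs hl
  obtain ⟨c, R₀, hc⟩ := hf (fun k => Nat.casesOn k s loc) (s + 1) (by omega) (fun k hk => by
    cases k with
    | zero => simp
    | succ k => exact (hl k (by omega)).trans (Nat.lt_succ_self s))
  obtain ⟨r, hr, hrb⟩ := hb loc s hs hl
  refine ⟨.seq (.clear s) (.whileLt s r (.seq c (.inc s))), max (s + 1) R₀,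
    fun R hR w B i m N t ρ hi he hρ => ?_⟩
  have hR' := max_le_iff.1 hR
  beta_reduce
  rw [← hrb m N t ρ he]
  have main : ∀ e x (ρ₁ : ℕ → ℕ), x + e = ρ r → ρ₁ s = x → (∀ r < s, ρ₁ r = ρ r) →
      (∀ r, ρ₁ r < 2 ^ B) → ∃ ρ' : ℕ → ℕ, (∀ r < s, ρ' r = ρ r) ∧ (∀ r, ρ' r < 2 ^ B) ∧
        Runs R w B (.whileLt s r (.seq c (.inc s))) ρ₁ i
          ((List.range' x e).flatMap fun x => f m N (x :: t)) ρ' i := by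
    intro e
    induction e with
    | zero =>
      intro x ρ₁ hx hs' hsame hlt
      refine ⟨ρ₁, hsame, hlt, ?_⟩
      refine Runs.whileLt_of_not_lt (by omega) (by omega) hi ?_
      rw [hs', hsame r hr]
      omega
    | succ e ih =>
      intro x ρ₁ hx hs' hsame hlt
      have he1 : Env (d + 1) (fun k => Nat.casesOn k s loc) m N (x :: t) ρ₁ := by
        refine ⟨by simp [he.length], by rw [hsame 0 (by omega), he.m_eq],
          by rw [hsame 1 (by omega), he.N_eq], fun k hk => ?_⟩
        cases k with
        | zero => simpa using hs'
        | succ k => simpa [hsame _ (hl k (by omega))] using he.loc_eq k (by omega)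
      obtain ⟨ρ₂, h2, hb2, hr2⟩ := hc R hR'.2 w B i m N (x :: t) ρ₁ hi he1 hlt
      have hs2 : ρ₂ s = x := by rw [h2 s (by omega), hs']
      -- The loop variable never exceeds the bounding register, which already fits into `B` bits.
      have hlt2 : ρ₂ s + 1 < 2 ^ B := by have := hρ r; omega
      obtain ⟨ρ₃, h3, hb3, hr3⟩ := ih (x + 1) (Function.update ρ₂ s (ρ₂ s + 1)) (by omega)
        (by simp [hs2])
        (fun q hq => by rw [Function.update_of_ne hq.ne, h2 q (by omega), hsame q hq])
        (fun q => by
          rcases eq_or_ne q s with rfl | h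
          · simpa using hlt2
          · rw [Function.update_of_ne h]
            exact hb2 q)
      refine ⟨ρ₃, h3, hb3, ?_⟩
      have := Runs.whileLt_of_lt (r := s) (s := r) (by omega) (by omega) hi
        (by rw [hs', hsame r hr]; omega) (hr2.seq hi (Runs.inc (by omega) hi hlt2)) hr3
      simpa [List.range'_succ] using this
  obtain ⟨ρ', h1, h2, h3⟩ := main (ρ r) 0 (Function.update ρ s 0) (by simp) (by simp)
    (fun q hq => by rw [Function.update_of_ne hq.ne])
    (fun q => by
      rcases eq_or_ne q s with rfl | h
      · simp
      · rw [Function.update_of_ne h]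
        exact hρ q)
  refine ⟨ρ', h1, h2, ?_⟩
  rw [List.range_eq_range']
  simpa using Runs.seq hi (Runs.clear s hi) h3

theorem weaken (hf : Gen d f) : Gen (d + 1) (fun m N t => f m N t.tail) := by
  refine (hf.rename (d' := d + 1) ((List.range d).map (· + 1)) (by simp) (by simp)).congr ?_
  intro m N t ht
  congr 1
  apply List.ext_getElem
  · simp [ht]
  · intro i h1 h2
    have h3 : i + 1 < t.length := by simp at h1; omega
    simp [h3]

end Gen

/-! ### The program that reads the input -/

/-- The input has been read up to letter `j`. -/
structure Scanned (B j : ℕ) (ρ : ℕ → ℕ) : Prop where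
  count : ρ 0 = j
  square : ρ 1 * ρ 1 + ρ 2 = j
  double : ρ 3 = 2 * ρ 1
  le : ρ 2 ≤ ρ 3
  bound : ∀ r, ρ r < 2 ^ B

/-- Update of the number of letters and of its integral square root. -/
def scanLetter : Cmd σ :=
  .seq (.inc 0) (.ite 2 3 (.inc 2)
    (.seq (.inc 1) (.seq (.inc 3) (.seq (.inc 3) (.clear 2)))))

theorem bound_update {B : ℕ} {ρ : ℕ → ℕ} (h : ∀ r, ρ r < 2 ^ B) {r v : ℕ} (hv : v < 2 ^ B)
    (q : ℕ) : Function.update ρ r v q < 2 ^ B := by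
  rcases eq_or_ne q r with rfl | hne
  · simpa using hv
  · rw [Function.update_of_ne hne]
    exact h q

/-- Registers `1`, `2`, `3` hold `q`, `j - q²` and `2q`. The remainder grows up to `2q`; the next
letter completes the square `(q + 1)² = q² + 2q + 1`, and the remainder restarts at zero. -/
theorem Scanned.runs {R : ℕ} (hR : 4 ≤ R) {w : List Unit} {B i j : ℕ} {ρ : ℕ → ℕ}
    (h : Scanned B j ρ) (hi : i ≤ w.length + 1) (hj : j + 3 < 2 ^ B) :
    ∃ ρ', Scanned B (j + 1) ρ' ∧ Runs (σ := σ) R w B scanLetter ρ i [] ρ' i := by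
  obtain ⟨h0, hsq, hdb, hle, hb⟩ := h
  -- Consequently the register with `2q` is at most `j + 1`, and at most `j + 3` after two
  -- increments; this explains the margin in `hj`.
  have h1 : 2 * ρ 1 ≤ ρ 1 * ρ 1 + 1 := by nlinarith [sq_nonneg ((ρ 1 : ℤ) - 1)]
  set ρ₁ := Function.update ρ 0 (ρ 0 + 1) with hρ₁
  have hr1 : Runs (σ := σ) R w B (.inc 0) ρ i [] ρ₁ i := Runs.inc (by omega) hi (by omega)
  have hb1 : ∀ r, ρ₁ r < 2 ^ B := bound_update hb (by omega)
  have e2 : ρ₁ 2 = ρ 2 := by simp [hρ₁]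
  have e3 : ρ₁ 3 = ρ 3 := by simp [hρ₁]
  by_cases hlt : ρ 2 < ρ 3
  · have hr2 : Runs (σ := σ) R w B (.inc 2) ρ₁ i [] (Function.update ρ₁ 2 (ρ₁ 2 + 1)) i :=
      Runs.inc (by omega) hi (by omega)
    refine ⟨_, ?_, Runs.seq (o' := []) hi hr1 (Runs.ite (by omega) (by omega) hi
      (by rw [if_pos (by omega)]; exact hr2))⟩
    refine ⟨by simp [hρ₁, h0], ?_, ?_, ?_, bound_update hb1 (by omega)⟩
    all_goals simp [hρ₁, Function.update]
    all_goals omega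
  · set ρ₂ := Function.update ρ₁ 1 (ρ₁ 1 + 1) with hρ₂
    have e1 : ρ₁ 1 = ρ 1 := by simp [hρ₁]
    have hr2 : Runs (σ := σ) R w B (.inc 1) ρ₁ i [] ρ₂ i := Runs.inc (by omega) hi (by omega)
    set ρ₃ := Function.update ρ₂ 3 (ρ₂ 3 + 1) with hρ₃
    have e4 : ρ₂ 3 = ρ 3 := by simp [hρ₁, hρ₂]
    have hr3 : Runs (σ := σ) R w B (.inc 3) ρ₂ i [] ρ₃ i := Runs.inc (by omega) hi (by omega)
    set ρ₄ := Function.update ρ₃ 3 (ρ₃ 3 + 1) with hρ₄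
    have e5 : ρ₃ 3 = ρ 3 + 1 := by simp [hρ₁, hρ₂, hρ₃]
    have hr4 : Runs (σ := σ) R w B (.inc 3) ρ₃ i [] ρ₄ i := Runs.inc (by omega) hi (by omega)
    have hr5 := (hr2.seq hi (hr3.seq hi (hr4.seq hi (Runs.clear 2 hi))))
    refine ⟨_, ?_, Runs.seq (o' := []) hi hr1 (Runs.ite (by omega) (by omega) hi
      (by rw [if_neg (by omega)]; exact hr5))⟩
    have h2 : (ρ 1 + 1) * (ρ 1 + 1) = ρ 1 * ρ 1 + 2 * ρ 1 + 1 := by ring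
    refine ⟨by simp [hρ₁, hρ₂, hρ₃, hρ₄, Function.update, h0], ?_, ?_, ?_,
      bound_update (bound_update (bound_update (bound_update hb1 ?_) ?_) ?_) ?_⟩
    all_goals simp [hρ₁, hρ₂, hρ₃, hρ₄, Function.update]
    all_goals omega

theorem ready_scan {R : ℕ} (hR : 4 ≤ R) {w : List Unit} {B : ℕ} (hB : w.length + 3 < 2 ^ B)
    {S : Set (List (Cmd σ))} [Finite S] {k₀ : S} {k : List (Cmd σ)} {out y : List σ}
    (hS : Cmd.conts (.eachLetter scanLetter) k ⊆ S)
    (hg : ∀ ρ, Scanned B w.length ρ → Ready R w B k₀ k ρ (w.length + 1) out y) {ρ : ℕ → ℕ}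
    {j : ℕ} (hj : j ≤ w.length) (hρ : Scanned B j ρ) :
    Ready R w B k₀ (.eachLetter scanLetter :: k) ρ (j + 1) out y := by
  obtain ⟨e, he⟩ : ∃ e, w.length = j + e := ⟨w.length - j, by omega⟩
  induction e generalizing j ρ with
  | zero =>
    obtain rfl : j = w.length := by omega
    exact Ready.eachLetter_rightEnd (hS (Cmd.mem_conts _ _)) (hg ρ hρ)
  | succ e ih =>
    obtain ⟨ρ', hρ', hr⟩ := hρ.runs (σ := σ) hR (w := w) (i := j + 2) (by omega) (by omega)
    refine Ready.eachLetter_letter (hS (Cmd.mem_conts _ _)) (by omega) ?_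
    refine hr S k₀ _ (fun x hx => hS (Or.inr hx)) (hS (Cmd.mem_conts _ _)) _ _ ?_
    simpa using ih (j := j + 1) (by omega) hρ' (by omega)

/-- What can be generated from `m` and its integral square root can be computed from `1ᵐ` in
logarithmic space. -/
theorem Gen.logspace {f : ℕ → ℕ → List ℕ → List σ} (hf : Gen 0 f) :
    ∃ (M : Transducer Unit σ) (c : ℕ), ∀ m : ℕ,
      M.ComputesWithin (List.replicate m ()) (f m m.sqrt []) (c * (Nat.log 2 m + 1)) := by
  obtain ⟨c, R₀, hc⟩ := hf (fun _ => 0) 2 le_rfl (by simp)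
  set p : Cmd σ := .seq (.eachLetter scanLetter) c
  set S : Set (List (Cmd σ)) := insert [] (p.conts [])
  have hfin : Finite S := ((p.finite_conts []).insert []).to_subtype
  have hpS : [p] ∈ S := Or.inr (Cmd.mem_conts _ _)
  -- The scan needs four registers. The space used is `B + 2 = log m + 6` cells, which is at most `6
  -- (log m + 1)`.
  refine ⟨machine (max 4 R₀) S ⟨[p], hpS⟩, 6, fun m => ?_⟩
  set w := List.replicate m ()
  set B := Nat.log 2 m + 4
  have hw : w.length = m := by simp [w]
  have hB : m + 3 < 2 ^ B := by
    have := Nat.lt_pow_succ_log_self (b := 2) (by norm_num) m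
    simp only [B, pow_succ] at this ⊢
    omega
  have key : (machine (max 4 R₀) S ⟨[p], hpS⟩).Good w (B + 2) (f m m.sqrt [])
      (conf ⟨[p], hpS⟩ [p] .init (fun _ => none) 0 0 []) := by
    refine good_conf hpS (q := ([p], .ready)) (d := .stay) (x := some none) (d' := .stay)
      (o := none) rfl (by omega) ?_
    have hR : Ready (max 4 R₀) w B ⟨[p], hpS⟩ [p] (fun _ => 0) 0 [] (f m m.sqrt []) := by
      refine Ready.seq hpS (by omega) ?_
      have hS1 : Cmd.conts (.eachLetter scanLetter) [c] ⊆ S :=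
        fun x hx => Or.inr (Or.inr (Or.inl hx))
      refine Ready.eachLetter_leftEnd (hS1 (Cmd.mem_conts _ _)) ?_
      refine ready_scan (le_max_left _ _) (by omega) hS1 (fun ρ hρ => ?_) (j := 0) (by omega)
        ⟨rfl, rfl, rfl, le_rfl, fun _ => Nat.two_pow_pos _⟩
      have hsq : ρ 1 = m.sqrt := by
        have h1 := hρ.square
        have h2 := hρ.double
        have h3 := hρ.le
        rw [hw] at h1
        rw [Nat.eq_sqrt]
        constructor
        · omega
        · have : (ρ 1 + 1) * (ρ 1 + 1) = ρ 1 * ρ 1 + 2 * ρ 1 + 1 := by ring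
          omega
      obtain ⟨ρ', -, hb, hr⟩ := hc (max 4 R₀) (le_max_right _ _) w B (w.length + 1) m m.sqrt [] ρ
        le_rfl ⟨rfl, by rw [hρ.count, hw], hsq, by simp⟩ hρ.bound
      refine hr S _ [] (fun x hx => Or.inr (Or.inr (Or.inr hx))) (Or.inl rfl) _ _ ?_
      intro T hT
      refine Transducer.Good.of_halted ?_ (fun _ => by simp [conf]) (by simp [conf])
      rw [next_conf (Or.inl rfl)]
      rfl
    have := hR (Function.update (fun _ => none) 0 (some none))
      ⟨0, by omega, by simp, by simp, by simp, by simp⟩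
    simpa [TapeMove.apply] using this
  have hst : (machine (max 4 R₀) S ⟨[p], hpS⟩).startConfig =
      conf ⟨[p], hpS⟩ [p] .init (fun _ => none) 0 0 [] := by
    simp only [Transducer.startConfig, conf, machine, clamp, hpS, dite_true]
  rw [← hst] at key
  exact ⟨key.1, fun d hd j => (key.2 d hd j).trans_le (by simp only [B]; omega)⟩

end Counter

open Counter

/-! ### Emission of numbers in unary -/

namespace Counter

/-- The number `a m N t` can be written down in unary. -/
abbrev TickGen (d : ℕ) (a : ℕ → ℕ → List ℕ → ℕ) : Prop :=
  Gen d fun m N t => List.replicate (a m N t) CircuitSymbol.tick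

namespace TickGen

variable {d : ℕ} {a b : ℕ → ℕ → List ℕ → ℕ}

theorem add (ha : TickGen d a) (hb : TickGen d b) : TickGen d fun m N t => a m N t + b m N t :=
  (Gen.append ha hb).congr fun _ _ _ _ => List.replicate_add _ _ _

/-- A loop bounded by the register `b` emits `a` ticks in every round. The product is never stored,
so it may exceed the range of the registers. -/
theorem mul (ha : TickGen d a) (hb : IsReg d b) : TickGen d fun m N t => a m N t * b m N t := by
  refine (Gen.flatMap hb (Gen.weaken ha)).congr fun m N t _ => ?_
  simp only [List.tail_cons]
  generalize b m N t = n
  induction n with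
  | zero => simp
  | succ n ih => rw [List.range_succ, List.flatMap_append, ← ih]; simp [Nat.mul_succ]

theorem zero (d : ℕ) : TickGen d fun _ _ _ => 0 := Gen.nil d

theorem one (d : ℕ) : TickGen d fun _ _ _ => 1 := Gen.emit d _

theorem reg (hb : IsReg d b) : TickGen d b :=
  ((one d).mul hb).congr fun m N t _ => by simp

theorem pow_N (d e : ℕ) : TickGen d fun _ N _ => N ^ e := by
  induction e with
  | zero => simpa using one d
  | succ e ih => simpa [pow_succ] using ih.mul (isReg_N d)

theorem of_zero {b : ℕ → ℕ → ℕ} (hb : TickGen 0 fun m N _ => b m N) (d : ℕ) :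
    TickGen d fun m N _ => b m N :=
  Gen.rename hb [] rfl (by simp)

theorem encodeNode (ha : TickGen d a) : Gen d fun m N t => encodeNode (a m N t) :=
  Gen.append ha (Gen.emit d _)

end TickGen

end Counter

/-! ### Layers of gates that are numbered by tuples -/

namespace Layered

/-- The number of a tuple in lexicographic order, where the last entry is the most significant. -/
def index (N : ℕ) : List ℕ → ℕ
  | [] => 0
  | x :: t => index N t * N + x

/-- The tuples of length `d` over `{0, …, N - 1}`. -/
def tuples (N : ℕ) : ℕ → List (List ℕ)
  | 0 => [[]]
  | d + 1 => (tuples N d).flatMap fun t => (List.range N).map (· :: t)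

theorem mem_tuples {N d : ℕ} {t : List ℕ} : t ∈ tuples N d ↔ t.length = d ∧ ∀ x ∈ t, x < N := by
  induction d generalizing t with
  | zero => cases t <;> simp [tuples]
  | succ d ih =>
    cases t with
    | nil => simp [tuples]
    | cons x t =>
      simp only [tuples, List.mem_flatMap, ih, List.mem_map, List.mem_range, List.cons.injEq,
        List.length_cons, Nat.add_right_cancel_iff, List.mem_cons, forall_eq_or_imp]
      constructor
      · rintro ⟨s, ⟨h1, h2⟩, y, hy, rfl, rfl⟩
        exact ⟨h1, hy, h2⟩
      · rintro ⟨h1, hy, h2⟩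
        exact ⟨t, ⟨h1, h2⟩, x, hy, rfl, rfl⟩

theorem cons_mem_tuples {N d x : ℕ} {t : List ℕ} :
    x :: t ∈ tuples N (d + 1) ↔ x < N ∧ t ∈ tuples N d := by
  simp only [mem_tuples, List.length_cons, Nat.add_right_cancel_iff, List.mem_cons,
    forall_eq_or_imp]
  tauto

theorem flatMap_range_mul (a N : ℕ) :
    (List.range a).flatMap (fun q => (List.range N).map fun x => q * N + x) =
      List.range (a * N) := by
  induction a with
  | zero => simp
  | succ a ih => simp [List.range_succ, ih, Nat.succ_mul, List.range_add]

/-- The enumeration order agrees with the numbering, so in a layer with one gate per tuple the gate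
of `t` has offset `index N t`. -/
theorem map_index_tuples (N d : ℕ) : (tuples N d).map (index N) = List.range (N ^ d) := by
  induction d with
  | zero => rfl
  | succ d ih =>
    rw [pow_succ, ← flatMap_range_mul, ← ih, tuples, List.map_flatMap, List.flatMap_map]
    simp [index, Function.comp_def]

theorem length_tuples (N d : ℕ) : (tuples N d).length = N ^ d := by
  have := congrArg List.length (map_index_tuples N d)
  simpa using this

theorem getElem?_tuples {N d : ℕ} {t : List ℕ} (ht : t ∈ tuples N d) :
    (tuples N d)[index N t]? = some t := by
  obtain ⟨i, hi, rfl⟩ := List.getElem_of_mem ht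
  have h : ((tuples N d).map (index N))[i]? = (List.range (N ^ d))[i]? := by
    rw [map_index_tuples]
  have hi' := hi
  rw [length_tuples] at hi'
  simp [hi, hi'] at h
  rw [h]
  simp [hi]

theorem index_lt {N d : ℕ} {t : List ℕ} (ht : t ∈ tuples N d) : index N t < N ^ d := by
  have h := getElem?_tuples ht
  rw [← length_tuples]
  exact (List.getElem?_eq_some_iff.1 h).1

/-- The tuple of the entries of `t` in the places `τ`. -/
abbrev pick (τ t : List ℕ) : List ℕ := τ.map fun j => t.getD j 0

theorem pick_mem_tuples {N d : ℕ} {τ t : List ℕ} (hτ : ∀ j ∈ τ, j < d) (ht : t ∈ tuples N d) :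
    pick τ t ∈ tuples N τ.length := by
  rw [mem_tuples] at ht ⊢
  refine ⟨by simp, fun x hx => ?_⟩
  obtain ⟨j, hj, rfl⟩ := List.mem_map.1 hx
  have hj' := hτ j hj
  rw [← ht.1] at hj'
  rw [List.getD_eq_getElem _ _ hj']
  exact ht.2 _ (List.getElem_mem _)

theorem pick_range {d : ℕ} {t : List ℕ} (ht : t.length = d) : pick (List.range d) t = t := by
  apply List.ext_getElem
  · simp [ht]
  · intro i h1 h2
    simp [h2]

theorem tickGen_index_pick {d : ℕ} {τ : List ℕ} (hτ : ∀ j ∈ τ, j < d) :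
    TickGen d fun _ N t => index N (pick τ t) := by
  induction τ with
  | nil => exact TickGen.zero d
  | cons j τ ih =>
    exact ((ih fun i hi => hτ i (List.mem_cons_of_mem _ hi)).mul (isReg_N d)).add
      (TickGen.reg (isReg_getD (hτ j List.mem_cons_self)))

theorem tickGen_index (d : ℕ) : TickGen d fun _ N t => index N t :=
  (tickGen_index_pick (d := d) (τ := List.range d) (by simp)).congr fun m N t ht => by
    simp only [pick_range ht]

theorem gen_tuples {σ : Type} {d : ℕ} {f : ℕ → ℕ → List ℕ → List σ} (hf : Gen d f) :
    Gen 0 fun m N _ => (tuples N d).flatMap (f m N) := by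
  induction d generalizing f with
  | zero =>
    refine hf.congr fun m N t ht => ?_
    rw [List.length_eq_zero_iff.1 ht]
    simp [tuples]
  | succ d ih =>
    refine (ih (Gen.flatMap (isReg_N d) hf)).congr fun m N t ht => ?_
    simp [tuples, List.flatMap_assoc, List.flatMap_map]

/-! ### Values and depths -/

/-- The values of all nodes. -/
abbrev values (g : List Gate) (x : List Bool) : List Bool := Circuit.nodeValues ⟨g, []⟩ x

/-- The depths of all nodes. -/
abbrev depths (m : ℕ) (g : List Gate) : List ℕ := Circuit.nodeDepths m ⟨g, []⟩

theorem prefix_foldl {α β : Type*} (F : List α → β → α) (l : List β) (v : List α) :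
    v <+: l.foldl (fun v b => v ++ [F v b]) v := by
  induction l generalizing v with
  | nil => exact List.prefix_rfl
  | cons b l ih => exact (List.prefix_append _ _).trans (ih _)

theorem length_foldl {α β : Type*} (F : List α → β → α) (l : List β) (v : List α) :
    (l.foldl (fun v b => v ++ [F v b]) v).length = v.length + l.length := by
  induction l generalizing v with
  | nil => rfl
  | cons b l ih => rw [List.foldl_cons, ih]; simp; omega

/-- Gates of one layer do not read each other, so their sequential evaluation is a `map` over the
layer. This serves both values and depths. -/
theorem foldl_eq_append {α β : Type*} (F : List α → β → α) (v : List α) {l : List β}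
    (h : ∀ b ∈ l, ∀ u, F (v ++ u) b = F v b) (u : List α) :
    l.foldl (fun v b => v ++ [F v b]) (v ++ u) = v ++ u ++ l.map (F v) := by
  induction l generalizing u with
  | nil => simp
  | cons b l ih =>
    rw [List.foldl_cons, h b List.mem_cons_self, List.append_assoc,
      ih (fun c hc => h c (List.mem_cons_of_mem _ hc))]
    simp

theorem getD_append_left {α : Type*} {v u : List α} {a : ℕ} (ha : a < v.length) (z : α) :
    (v ++ u).getD a z = v.getD a z := by
  simp [List.getD, List.getElem?_append_left ha]

theorem getD_of_prefix {α : Type*} {v u : List α} (h : v <+: u) {a : ℕ} (ha : a < v.length)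
    (z : α) : u.getD a z = v.getD a z := by
  obtain ⟨w, rfl⟩ := h
  exact getD_append_left ha z

theorem length_values (g : List Gate) (x : List Bool) :
    (values g x).length = x.length + g.length :=
  length_foldl (fun v (b : Gate) => b.value v) g x

theorem prefix_values (g : List Gate) (x : List Bool) : x <+: values g x :=
  prefix_foldl (fun v (b : Gate) => b.value v) g x

theorem values_prefix_of_prefix {g g' : List Gate} (h : g <+: g') (x : List Bool) :
    values g x <+: values g' x := by
  obtain ⟨l, rfl⟩ := h
  simp only [values, Circuit.nodeValues, List.foldl_append]
  exact prefix_foldl (fun v b => Gate.value b v) l _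

theorem length_depths (m : ℕ) (g : List Gate) : (depths m g).length = m + g.length := by
  refine (length_foldl (fun (ds : List ℕ) (g : Gate) =>
    (g.args.map fun a => ds.getD a 0).foldr max 0 + 1) g (List.replicate m 0)).trans ?_
  rw [List.length_replicate]

/-- The hypothesis `hnot` excludes a negation without arguments: it would read the default node `0`,
which could be one of the appended nodes. -/
theorem value_append {γ : Gate} {v : List Bool} (h : ∀ a ∈ γ.args, a < v.length)
    (hnot : γ.kind = .not → γ.args.length = 1) (u : List Bool) :
    γ.value (v ++ u) = γ.value v := by
  have h' : ∀ a ∈ γ.args, (v ++ u).getD a false = v.getD a false :=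
    fun a ha => getD_append_left (h a ha) _
  rcases γ with ⟨kind, args⟩
  cases kind with
  | and =>
    simp only [Gate.value]
    rw [Bool.eq_iff_iff, List.all_eq_true, List.all_eq_true]
    exact forall₂_congr fun a ha => by rw [h' a ha]
  | or =>
    simp only [Gate.value]
    rw [Bool.eq_iff_iff, List.any_eq_true, List.any_eq_true]
    exact exists_congr fun a => and_congr_right fun ha => by rw [h' a ha]
  | not =>
    obtain ⟨a, rfl⟩ := List.length_eq_one_iff.1 (hnot rfl)
    simp only [Gate.value, List.headD_cons]
    rw [h' a (by simp)]
  | maj =>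
    simp only [Gate.value]
    rw [List.countP_congr fun a ha => by rw [h' a ha]]

theorem values_append_layer {g l : List Gate} {x : List Bool}
    (h : ∀ γ ∈ l, ∀ a ∈ γ.args, a < x.length + g.length)
    (hnot : ∀ γ ∈ l, γ.kind = .not → γ.args.length = 1) :
    values (g ++ l) x = values g x ++ l.map fun γ => γ.value (values g x) := by
  have := foldl_eq_append (fun v (b : Gate) => b.value v) (values g x) (l := l)
    (fun γ hγ u => value_append (by rw [length_values]; exact h γ hγ) (hnot γ hγ) u) []
  simpa [values, Circuit.nodeValues] using this

theorem foldr_max_le {l : List ℕ} {D : ℕ} (h : ∀ x ∈ l, x ≤ D) : l.foldr max 0 ≤ D := by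
  induction l with
  | nil => simp
  | cons a l ih =>
    rw [List.foldr_cons]
    exact max_le (h a List.mem_cons_self) (ih fun x hx => h x (List.mem_cons_of_mem _ hx))

theorem getD_le {l : List ℕ} {D : ℕ} (h : ∀ x ∈ l, x ≤ D) (a : ℕ) : l.getD a 0 ≤ D := by
  rcases lt_or_ge a l.length with ha | ha
  · rw [List.getD_eq_getElem _ _ ha]
    exact h _ (List.getElem_mem _)
  · rw [List.getD_eq_default _ _ ha]
    exact Nat.zero_le _

theorem depths_append_layer_le {g l : List Gate} {m D : ℕ}
    (h : ∀ γ ∈ l, ∀ a ∈ γ.args, a < m + g.length) (hD : ∀ x ∈ depths m g, x ≤ D) :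
    ∀ x ∈ depths m (g ++ l), x ≤ D + 1 := by
  have := foldl_eq_append (fun (ds : List ℕ) (g : Gate) =>
    (g.args.map fun a => ds.getD a 0).foldr max 0 + 1) (depths m g) (l := l)
    (fun γ hγ u => by
      congr 2
      refine List.map_congr_left fun a ha => getD_append_left ?_ _
      rw [length_depths]
      exact h γ hγ a ha) []
  have he : depths m (g ++ l) = depths m g ++ l.map fun γ =>
      (γ.args.map fun a => (depths m g).getD a 0).foldr max 0 + 1 := by
    simpa [depths, Circuit.nodeDepths] using this
  intro x hx
  rw [he, List.mem_append] at hx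
  rcases hx with hx | hx
  · exact (hD x hx).trans (Nat.le_succ D)
  · obtain ⟨γ, -, rfl⟩ := List.mem_map.1 hx
    refine Nat.succ_le_succ (foldr_max_le fun y hy => ?_)
    obtain ⟨a, -, rfl⟩ := List.mem_map.1 hy
    exact getD_le hD a

/-! ### Uniform families of gates -/

/-- A uniform family of circuits of polynomial size and constant depth on `m` inputs, which depends
on a second number `N` with `N² ≤ m`; majority gates are allowed if `maj` is true. -/
structure IsStage (maj : Bool) (g : ℕ → ℕ → List Gate) : Prop where
  args_lt : ∀ m N, N * N ≤ m → ∀ i γ, (g m N)[i]? = some γ → ∀ a ∈ γ.args, a < m + i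
  not_unary : ∀ m N, ∀ γ ∈ g m N, γ.kind = .not → γ.args.length = 1
  noMaj : maj = false → ∀ m N, ∀ γ ∈ g m N, γ.kind ≠ .maj
  size : ∃ c, ∀ m N, N * N ≤ m → (⟨g m N, []⟩ : Circuit).size ≤ (m + 2) ^ c
  depth : ∃ D, ∀ m N, N * N ≤ m → ∀ x ∈ depths m (g m N), x ≤ D
  tickGen_length : TickGen 0 fun m N _ => (g m N).length
  gen : Gen 0 fun m N _ => (g m N).flatMap Gate.encode

theorem isStage_nil (maj : Bool) : IsStage maj fun _ _ => [] where
  args_lt := by simp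
  not_unary := by simp
  noMaj := by simp
  size := ⟨0, by simp [Circuit.size]⟩
  depth := ⟨0, fun m N _ x hx => by
    have := List.eq_of_mem_replicate hx
    omega⟩
  tickGen_length := Gen.nil 0
  gen := Gen.nil 0

/-- A property of tuples of numbers less than `N`, given `N` and a relation on these numbers. -/
abbrev Query := ℕ → (ℕ → ℕ → Prop) → List ℕ → Prop

/-- The relation whose matrix, written row by row, is `x`. -/
def rel (N : ℕ) (x : List Bool) (u v : ℕ) : Prop := x.getD (u * N + v) false = true

/-- The truth values of the query `P` are the values of consecutive nodes, starting at `b m N`. -/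
structure ComputesAt (g : ℕ → ℕ → List Gate) (d : ℕ) (P : Query) (b : ℕ → ℕ → ℕ) : Prop where
  tickGen : TickGen 0 fun m N _ => b m N
  lt : ∀ m N, N * N ≤ m → ∀ t ∈ tuples N d, b m N + index N t < m + (g m N).length
  value : ∀ m N, N * N ≤ m → ∀ x : List Bool, x.length = m → ∀ t ∈ tuples N d,
    ((values (g m N) x).getD (b m N + index N t) false = true ↔ P N (rel N x) t)

theorem ComputesAt.mono {g g' : ℕ → ℕ → List Gate} {d : ℕ} {P : Query} {b : ℕ → ℕ → ℕ}
    (h : ComputesAt g d P b) (hg : ∀ m N, g m N <+: g' m N) : ComputesAt g' d P b where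
  tickGen := h.tickGen
  lt m N hN t ht := (h.lt m N hN t ht).trans_le (by have := (hg m N).length_le; omega)
  value m N hN x hx t ht := by
    rw [← h.value m N hN x hx t ht, getD_of_prefix (values_prefix_of_prefix (hg m N) x)]
    rw [length_values, hx]
    exact h.lt m N hN t ht

/-- Every family of circuits can be extended so that it computes the query `P`. -/
def Definable (maj : Bool) (d : ℕ) (P : Query) : Prop :=
  ∀ g, IsStage maj g → ∃ g', IsStage maj g' ∧ (∀ m N, g m N <+: g' m N) ∧
    ∃ b, ComputesAt g' d P b

/-- Addition of a layer with the gates `γ m N t`, for all tuples `t` of length `d`. -/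
theorem IsStage.extend {maj : Bool} {g : ℕ → ℕ → List Gate} (hg : IsStage maj g) {d : ℕ}
    {P : Query} (γ : ℕ → ℕ → List ℕ → Gate) (hgen : Gen d fun m N t => (γ m N t).encode)
    (hargs : ∀ m N, N * N ≤ m → ∀ t ∈ tuples N d, ∀ a ∈ (γ m N t).args,
      a < m + (g m N).length)
    (hnot : ∀ m N t, (γ m N t).kind = .not → (γ m N t).args.length = 1)
    (hmaj : maj = false → ∀ m N t, (γ m N t).kind ≠ .maj)
    (hsize : ∃ c, ∀ m N, N * N ≤ m → ∀ t, (γ m N t).args.length ≤ (m + 2) ^ c)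
    (hval : ∀ m N, N * N ≤ m → ∀ x : List Bool, x.length = m → ∀ t ∈ tuples N d,
      ((γ m N t).value (values (g m N) x) = true ↔ P N (rel N x) t)) :
    ∃ g', IsStage maj g' ∧ (∀ m N, g m N <+: g' m N) ∧ ∃ b, ComputesAt g' d P b := by
  have hargs' : ∀ m N, N * N ≤ m → ∀ γ' ∈ (tuples N d).map (γ m N), ∀ a ∈ γ'.args,
      a < m + (g m N).length := by
    intro m N hN γ' hγ'
    obtain ⟨t, ht, rfl⟩ := List.mem_map.1 hγ'
    exact hargs m N hN t ht
  have hnot' : ∀ m N, ∀ γ' ∈ (tuples N d).map (γ m N), γ'.kind = .not → γ'.args.length = 1 := by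
    intro m N γ' hγ'
    obtain ⟨t, ht, rfl⟩ := List.mem_map.1 hγ'
    exact hnot m N t
  refine ⟨fun m N => g m N ++ (tuples N d).map (γ m N), ?_, fun m N => List.prefix_append _ _,
    fun m N => m + (g m N).length, ?_⟩
  · constructor
    · intro m N hN i γ' hγ' a ha
      rcases lt_or_ge i (g m N).length with hi | hi
      · rw [List.getElem?_append_left hi] at hγ'
        exact hg.args_lt m N hN i γ' hγ' a ha
      · rw [List.getElem?_append_right hi] at hγ'
        exact (hargs' m N hN γ' (List.mem_of_getElem? hγ') a ha).trans_le (by omega)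
    · intro m N γ' hγ'
      rcases List.mem_append.1 hγ' with h | h
      · exact hg.not_unary m N γ' h
      · exact hnot' m N γ' h
    · intro hm m N γ' hγ'
      rcases List.mem_append.1 hγ' with h | h
      · exact hg.noMaj hm m N γ' h
      · obtain ⟨t, ht, rfl⟩ := List.mem_map.1 h
        exact hmaj hm m N t
    · obtain ⟨c, hc⟩ := hg.size
      obtain ⟨e, he⟩ := hsize
      -- Old gates contribute `c`, the number of tuples `d`, and a gate with its wires `e + 1`. The
      -- last `+ 1` absorbs the sum of two powers, since the base `m + 2` is at least `2`.
      refine ⟨c + (d + (e + 1)) + 1, fun m N hN => ?_⟩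
      have hNm : N ≤ m + 2 := by nlinarith
      have h1 : ∀ l : List (List ℕ), ((l.map (γ m N)).map fun g => g.args.length).sum ≤
          l.length * (m + 2) ^ e := by
        intro l
        induction l with
        | nil => simp
        | cons t l ih =>
          simp only [List.map_cons, List.sum_cons, List.length_cons, Nat.succ_mul]
          have := he m N hN t
          omega
      have h2 := h1 (tuples N d)
      have h3 := hc m N hN
      rw [length_tuples] at h2
      have h4 : N ^ d ≤ (m + 2) ^ d := Nat.pow_le_pow_left hNm d
      have h5 : 1 ≤ (m + 2) ^ e := Nat.one_le_pow _ _ (by omega)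
      have h6 : N ^ d + N ^ d * (m + 2) ^ e ≤ (m + 2) ^ (d + (e + 1)) := by
        rw [pow_add, pow_succ]
        calc N ^ d + N ^ d * (m + 2) ^ e = N ^ d * (1 + (m + 2) ^ e) := by ring
          _ ≤ (m + 2) ^ d * ((m + 2) ^ e * (m + 2)) := by
            refine Nat.mul_le_mul h4 ?_
            nlinarith
      have h7 : (m + 2) ^ c + (m + 2) ^ (d + (e + 1)) ≤
          (m + 2) ^ (c + (d + (e + 1)) + 1) := by
        rw [pow_succ]
        have h8 : (m + 2) ^ c ≤ (m + 2) ^ (c + (d + (e + 1))) :=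
          Nat.pow_le_pow_right (by omega) (by omega)
        have h9 : (m + 2) ^ (d + (e + 1)) ≤ (m + 2) ^ (c + (d + (e + 1))) :=
          Nat.pow_le_pow_right (by omega) (by omega)
        nlinarith
      simp only [Circuit.size, List.length_append, List.map_append, List.sum_append,
        List.length_map, length_tuples] at h3 h2 ⊢
      omega
    · obtain ⟨D, hD⟩ := hg.depth
      exact ⟨D + 1, fun m N hN => depths_append_layer_le (hargs' m N hN) (hD m N hN)⟩
    · simpa [length_tuples] using hg.tickGen_length.add (TickGen.pow_N 0 d)
    · refine (hg.gen.append (gen_tuples hgen)).congr fun m N t _ => ?_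
      simp [List.flatMap_map]
  · constructor
    -- The new layer begins after the inputs and the old gates. Later layers must print this
    -- address, which is why a stage records that its length can be generated.
    · exact (TickGen.reg (isReg_m 0)).add hg.tickGen_length
    · intro m N hN t ht
      have := index_lt ht
      simp only [List.length_append, List.length_map, length_tuples]
      omega
    · intro m N hN x hx t ht
      rw [← hval m N hN x hx t ht, values_append_layer (by rw [hx]; exact hargs' m N hN)
        (hnot' m N)]
      simp only [List.getD]
      rw [List.getElem?_append_right (by rw [length_values, hx]; omega), length_values, hx,
        Nat.add_sub_cancel_left, List.getElem?_map, List.getElem?_map, getElem?_tuples ht]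
      rfl

end Layered

/-! ### Closure of definable queries under logical operations and counting -/

namespace Layered

theorem tickGen_address {b : ℕ → ℕ → ℕ} (hb : TickGen 0 fun m N _ => b m N) (d : ℕ) :
    TickGen d fun m N t => b m N + index N t :=
  (hb.of_zero d).add (tickGen_index d)

namespace Definable

variable {maj : Bool} {d : ℕ} {P Q : Query}

theorem congr (hP : Definable maj d P)
    (h : ∀ N A, ∀ t ∈ tuples N d, (Q N A t ↔ P N A t)) : Definable maj d Q := by
  intro g hg
  obtain ⟨g', hg', hpre, b, hb⟩ := hP g hg
  exact ⟨g', hg', hpre, b, hb.tickGen, hb.lt, fun m N hN x hx t ht =>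
    (hb.value m N hN x hx t ht).trans (h N _ t ht).symm⟩

/-- A layer on top of the gates that compute `P`. -/
theorem of_layer (hP : Definable maj d P) {d' : ℕ} (γ : (ℕ → ℕ → ℕ) → ℕ → ℕ → List ℕ → Gate)
    (hgen : ∀ b : ℕ → ℕ → ℕ, (TickGen 0 fun m N _ => b m N) →
      Gen d' fun m N t => (γ b m N t).encode)
    (hargs : ∀ b m N t, t ∈ tuples N d' → ∀ a ∈ (γ b m N t).args,
      ∃ s ∈ tuples N d, a = b m N + index N s)
    (hnot : ∀ b m N t, (γ b m N t).kind = .not → (γ b m N t).args.length = 1)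
    (hmaj : maj = false → ∀ b m N t, (γ b m N t).kind ≠ .maj)
    (hsize : ∀ b m N t, N * N ≤ m → (γ b m N t).args.length ≤ m + 2)
    (hval : ∀ b m N A t (v : List Bool), t ∈ tuples N d' →
      (∀ s ∈ tuples N d, (v.getD (b m N + index N s) false = true ↔ P N A s)) →
      ((γ b m N t).value v = true ↔ Q N A t)) :
    Definable maj d' Q := by
  intro g hg
  obtain ⟨g', hg', hpre, b, hb⟩ := hP g hg
  obtain ⟨g'', hg'', hpre', h⟩ := hg'.extend (P := Q) (γ b) (hgen b hb.tickGen)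
    (fun m N hN t ht a ha => by
      obtain ⟨s, hs, rfl⟩ := hargs b m N t ht a ha
      exact hb.lt m N hN s hs) (hnot b) (fun hm => hmaj hm b)
    ⟨1, fun m N hN t => by simpa using hsize b m N t hN⟩
    (fun m N hN x hx t ht => hval b m N _ t _ ht (hb.value m N hN x hx))
  exact ⟨g'', hg'', fun m N => (hpre m N).trans (hpre' m N), h⟩

/-- A layer on top of the gates that compute `P` and `Q`. -/
theorem of_layer₂ {P' : Query} (hP : Definable maj d P) {e : ℕ} (hP' : Definable maj e P')
    {d' : ℕ} (γ : (ℕ → ℕ → ℕ) → (ℕ → ℕ → ℕ) → ℕ → ℕ → List ℕ → Gate)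
    (hgen : ∀ b b' : ℕ → ℕ → ℕ, (TickGen 0 fun m N _ => b m N) →
      (TickGen 0 fun m N _ => b' m N) → Gen d' fun m N t => (γ b b' m N t).encode)
    (hargs : ∀ b b' m N t, t ∈ tuples N d' → ∀ a ∈ (γ b b' m N t).args,
      (∃ s ∈ tuples N d, a = b m N + index N s) ∨ ∃ s ∈ tuples N e, a = b' m N + index N s)
    (hnot : ∀ b b' m N t, (γ b b' m N t).kind = .not → (γ b b' m N t).args.length = 1)
    (hmaj : maj = false → ∀ b b' m N t, (γ b b' m N t).kind ≠ .maj)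
    (hsize : ∀ b b' m N t, N * N ≤ m → (γ b b' m N t).args.length ≤ (m + 2) ^ 2)
    (hval : ∀ b b' m N A t (v : List Bool), t ∈ tuples N d' →
      (∀ s ∈ tuples N d, (v.getD (b m N + index N s) false = true ↔ P N A s)) →
      (∀ s ∈ tuples N e, (v.getD (b' m N + index N s) false = true ↔ P' N A s)) →
      ((γ b b' m N t).value v = true ↔ Q N A t)) :
    Definable maj d' Q := by
  intro g hg
  obtain ⟨g₁, hg₁, hpre₁, b, hb⟩ := hP g hg
  obtain ⟨g₂, hg₂, hpre₂, b', hb'⟩ := hP' g₁ hg₁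
  replace hb := hb.mono hpre₂
  obtain ⟨g₃, hg₃, hpre₃, h⟩ := hg₂.extend (P := Q) (γ b b') (hgen b b' hb.tickGen hb'.tickGen)
    (fun m N hN t ht a ha => by
      rcases hargs b b' m N t ht a ha with ⟨s, hs, rfl⟩ | ⟨s, hs, rfl⟩
      · exact hb.lt m N hN s hs
      · exact hb'.lt m N hN s hs) (hnot b b') (fun hm => hmaj hm b b')
    ⟨2, fun m N hN t => hsize b b' m N t hN⟩
    (fun m N hN x hx t ht => hval b b' m N _ t _ ht (hb.value m N hN x hx)
      (hb'.value m N hN x hx))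
  exact ⟨g₃, hg₃, fun m N => ((hpre₁ m N).trans (hpre₂ m N)).trans (hpre₃ m N), h⟩

/-- A disjunction with a single wire copies the matrix bit. The places are listed as `[j, i]`
because `index` takes the last entry as the most significant one. -/
theorem adj {i j : ℕ} (hi : i < d) (hj : j < d) :
    Definable maj d fun _ A t => A (t.getD i 0) (t.getD j 0) := by
  intro g hg
  have hτ : ∀ k ∈ [j, i], k < d := by simp [hi, hj]
  have hlt : ∀ N t, t ∈ tuples N d → index N (pick [j, i] t) < N * N := fun N t ht => by
    simpa [sq] using index_lt (pick_mem_tuples hτ ht)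
  refine hg.extend (fun m N t => ⟨.or, [index N (pick [j, i] t)]⟩) ?_ ?_ (by simp) (by simp)
    ⟨0, by simp⟩ ?_
  · refine (Gen.cons (.gate .or) (TickGen.encodeNode (tickGen_index_pick hτ))).congr ?_
    intro m N t _
    simp [Gate.encode]
  · intro m N hN t ht a ha
    have := hlt N t ht
    simp only [List.mem_singleton] at ha
    omega
  · intro m N hN x hx t ht
    have := hlt N t ht
    simp only [Gate.value, List.any_cons, List.any_nil, Bool.or_false, rel]
    rw [getD_of_prefix (prefix_values _ _) (by omega)]
    simp [index]

/-- The answer depends on the tuple and not on the input, so the generating program decides it and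
prints a constant: an empty conjunction for true, an empty disjunction for false. -/
theorem lt {i j : ℕ} (hi : i < d) (hj : j < d) :
    Definable maj d fun _ _ t => t.getD i 0 < t.getD j 0 := by
  intro g hg
  refine hg.extend (fun m N t => if t.getD i 0 < t.getD j 0 then ⟨.and, []⟩ else ⟨.or, []⟩)
    ?_ ?_ ?_ ?_ ⟨0, ?_⟩ ?_
  · refine (Gen.ite (isReg_getD hi) (isReg_getD hj) (Gen.emit d (.gate .and))
      (Gen.emit d (.gate .or))).congr ?_
    intro m N t _
    split_ifs <;> simp [Gate.encode]
  · intro m N hN t ht a ha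
    split_ifs at ha <;> simp at ha
  · intro m N t h
    split_ifs at h
  · intro _ m N t
    split_ifs <;> simp
  · intro m N _ t
    split_ifs <;> simp
  · intro m N hN x hx t ht
    split_ifs with h <;> simpa [Gate.value] using h

theorem comap (τ : List ℕ) (hτ : ∀ j ∈ τ, j < d) (hP : Definable maj τ.length P) :
    Definable maj d fun N A t => P N A (pick τ t) := by
  refine hP.of_layer (fun b m N t => ⟨.or, [b m N + index N (pick τ t)]⟩) ?_ ?_ (by simp)
    (by simp) (by simp) ?_
  · intro b hb
    refine (Gen.cons (.gate .or)
      (TickGen.encodeNode ((hb.of_zero d).add (tickGen_index_pick hτ)))).congr ?_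
    intro m N t _
    simp [Gate.encode]
  · intro b m N t ht a ha
    exact ⟨_, pick_mem_tuples hτ ht, by simpa using ha⟩
  · intro b m N A t v ht hv
    simpa [Gate.value] using hv _ (pick_mem_tuples hτ ht)

theorem not (hP : Definable maj d P) : Definable maj d fun N A t => ¬ P N A t := by
  refine hP.of_layer (fun b m N t => ⟨.not, [b m N + index N t]⟩) ?_ ?_ (by simp)
    (by simp) (by simp) ?_
  · intro b hb
    refine (Gen.cons (.gate .not) (TickGen.encodeNode (tickGen_address hb d))).congr ?_
    intro m N t _
    simp [Gate.encode]
  · intro b m N t ht a ha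
    exact ⟨t, ht, by simpa using ha⟩
  · intro b m N A t v ht hv
    rw [← hv t ht]
    simp [Gate.value]

theorem and (hP : Definable maj d P) (hQ : Definable maj d Q) :
    Definable maj d fun N A t => P N A t ∧ Q N A t := by
  refine hP.of_layer₂ hQ (fun b b' m N t => ⟨.and, [b m N + index N t, b' m N + index N t]⟩)
    ?_ ?_ (by simp) (by simp) ?_ ?_
  · intro b b' hb hb'
    refine (Gen.cons (.gate .and) ((TickGen.encodeNode (tickGen_address hb d)).append
      (TickGen.encodeNode (tickGen_address hb' d)))).congr ?_
    intro m N t _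
    simp [Gate.encode]
  · intro b b' m N t ht a ha
    simp only [List.mem_cons, List.not_mem_nil, or_false] at ha
    rcases ha with rfl | rfl
    · exact Or.inl ⟨t, ht, rfl⟩
    · exact Or.inr ⟨t, ht, rfl⟩
  · intro b b' m N t _
    simp only [List.length_cons, List.length_nil]
    nlinarith
  · intro b b' m N A t v ht hv hv'
    rw [← hv t ht, ← hv' t ht]
    simp [Gate.value]

theorem or (hP : Definable maj d P) (hQ : Definable maj d Q) :
    Definable maj d fun N A t => P N A t ∨ Q N A t :=
  (hP.not.and hQ.not).not.congr fun _ _ _ _ => by tauto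

theorem imp (hP : Definable maj d P) (hQ : Definable maj d Q) :
    Definable maj d fun N A t => P N A t → Q N A t :=
  (hP.and hQ.not).not.congr fun _ _ _ _ => by tauto

theorem eq {i j : ℕ} (hi : i < d) (hj : j < d) :
    Definable maj d fun _ _ t => t.getD i 0 = t.getD j 0 :=
  ((lt hi hj).or (lt hj hi)).not.congr fun _ _ _ _ => by omega

theorem exists_lt (hP : Definable maj (d + 1) P) :
    Definable maj d fun N A t => ∃ x < N, P N A (x :: t) := by
  refine hP.of_layer
    (fun b m N t => ⟨.or, (List.range N).map fun x => b m N + index N (x :: t)⟩) ?_ ?_ (by simp)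
    (by simp) ?_ ?_
  · intro b hb
    refine (Gen.cons (.gate .or) (Gen.flatMap (isReg_N d)
      (TickGen.encodeNode (tickGen_address hb (d + 1))))).congr ?_
    intro m N t _
    simp [Gate.encode, List.flatMap_map]
  · intro b m N t ht a ha
    obtain ⟨x, hx, rfl⟩ := List.mem_map.1 ha
    exact ⟨x :: t, cons_mem_tuples.2 ⟨List.mem_range.1 hx, ht⟩, rfl⟩
  · intro b m N t hN
    rw [List.length_map, List.length_range]
    nlinarith
  · intro b m N A t v ht hv
    simp only [Gate.value, List.any_map, List.any_eq_true, List.mem_range, Function.comp]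
    exact exists_congr fun x => and_congr_right fun hx => hv _ (cons_mem_tuples.2 ⟨hx, ht⟩)

theorem forall_lt (hP : Definable maj (d + 1) P) :
    Definable maj d fun N A t => ∀ x < N, P N A (x :: t) :=
  hP.not.exists_lt.not.congr fun _ _ _ _ => by push Not; rfl

theorem const_true : Definable maj d fun _ _ _ => True := by
  intro g hg
  refine hg.extend (fun m N t => ⟨.and, []⟩) ?_ (by simp) (by simp) (by simp) ⟨0, by simp⟩
    (by simp [Gate.value])
  simpa [Gate.encode] using Gen.emit d (CircuitSymbol.gate .and)

end Definable

open Classical in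
/-- The number of pairs that satisfy `p`. -/
noncomputable def pairCount (N : ℕ) (p : ℕ → ℕ → Prop) : ℕ :=
  ((Finset.range N ×ˢ Finset.range N).filter fun z => p z.1 z.2).card

open Classical in
theorem countP_pairs (N : ℕ) (p : ℕ → ℕ → Prop) (q : ℕ → Bool) (a : ℕ → ℕ → ℕ)
    (h : ∀ y < N, ∀ x < N, (q (a y x) = true ↔ p y x)) :
    ((List.range N).flatMap fun y => (List.range N).map fun x => a y x).countP q =
      pairCount N p := by
  have h1 : ((List.range N).flatMap fun y => (List.range N).map fun x => a y x) =
      ((List.range N).product (List.range N)).map fun z => a z.1 z.2 := by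
    simp [List.product, List.map_flatMap, Function.comp_def]
  rw [h1, List.countP_map, pairCount]
  have h2 : (Finset.range N ×ˢ Finset.range N).val =
      (((List.range N).product (List.range N) : List (ℕ × ℕ)) : Multiset (ℕ × ℕ)) :=
    Multiset.coe_product _ _
  rw [Finset.card_def, Finset.filter_val, h2, Multiset.filter_coe, Multiset.coe_card,
    List.countP_eq_length_filter]
  congr 1
  refine List.filter_congr fun z hz => ?_
  have hz' := List.mem_product.1 hz
  rw [List.mem_range, List.mem_range] at hz'
  have := h z.1 hz'.1 z.2 hz'.2
  rw [Bool.eq_iff_iff, decide_eq_true_eq]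
  exact this

/-- One majority gate reads the `N²` values of `P` and the `N²` values of `¬ Q`. At least half of
these `2N²` inputs are true iff `#P + (N² - #Q) ≥ N²`, that is, `#Q ≤ #P`. -/
theorem Definable.pairCount_le {d : ℕ} {P Q : Query} (hP : Definable true (d + 2) P)
    (hQ : Definable true (d + 2) Q) :
    Definable true d fun N A t =>
      pairCount N (fun y x => Q N A (x :: y :: t)) ≤ pairCount N fun y x => P N A (x :: y :: t) := by
  have hlen : ∀ (b : ℕ → ℕ → ℕ) m N t, ((List.range N).flatMap fun y => (List.range N).map
      fun x => b m N + index N (x :: y :: t)).length = N * N := by simp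
  have hgen : ∀ b : ℕ → ℕ → ℕ, (TickGen 0 fun m N _ => b m N) → Gen d fun m N t =>
      ((List.range N).flatMap fun y => (List.range N).map
        fun x => b m N + index N (x :: y :: t)).flatMap encodeNode := fun b hb => by
    refine (Gen.flatMap (isReg_N d) (Gen.flatMap (isReg_N (d + 1))
      (TickGen.encodeNode (tickGen_address hb (d + 2))))).congr ?_
    intro m N t _
    simp [List.flatMap_map, List.flatMap_assoc]
  refine hP.of_layer₂ hQ.not (fun b b' m N t => ⟨.maj,
    ((List.range N).flatMap fun y => (List.range N).map fun x => b m N + index N (x :: y :: t)) ++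
    (List.range N).flatMap fun y => (List.range N).map fun x => b' m N + index N (x :: y :: t)⟩)
    ?_ ?_ (by simp) (by simp) ?_ ?_
  · intro b b' hb hb'
    refine (Gen.cons (.gate .maj) ((hgen b hb).append (hgen b' hb'))).congr ?_
    intro m N t _
    simp only [Gate.encode, List.flatMap_append]
  · intro b b' m N t ht a ha
    have : ∀ {y x}, y < N → x < N → x :: y :: t ∈ tuples N (d + 2) := fun hy hx =>
      cons_mem_tuples.2 ⟨hx, cons_mem_tuples.2 ⟨hy, ht⟩⟩
    simp only [List.mem_append, List.mem_flatMap, List.mem_map, List.mem_range] at ha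
    rcases ha with ⟨y, hy, x, hx, rfl⟩ | ⟨y, hy, x, hx, rfl⟩
    · exact Or.inl ⟨_, this hy hx, rfl⟩
    · exact Or.inr ⟨_, this hy hx, rfl⟩
  · intro b b' m N t hN
    simp only [List.length_append, hlen]
    nlinarith
  · intro b b' m N A t v ht hv hv'
    have hmem : ∀ y < N, ∀ x < N, x :: y :: t ∈ tuples N (d + 2) := fun y hy x hx =>
      cons_mem_tuples.2 ⟨hx, cons_mem_tuples.2 ⟨hy, ht⟩⟩
    simp only [Gate.value, List.length_append, hlen, List.countP_append, decide_eq_true_eq]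
    rw [countP_pairs N (fun y x => P N A (x :: y :: t)) _
        (fun y x => b m N + index N (x :: y :: t)) fun y hy x hx => hv _ (hmem y hy x hx),
      countP_pairs N (fun y x => ¬ Q N A (x :: y :: t)) _
        (fun y x => b' m N + index N (x :: y :: t)) fun y hy x hx => hv' _ (hmem y hy x hx)]
    have : pairCount N (fun y x => Q N A (x :: y :: t)) +
        pairCount N (fun y x => ¬ Q N A (x :: y :: t)) = N * N := by
      classical
      unfold pairCount
      rw [Finset.card_filter_add_card_filter_not]
      simp
    omega

/-! ### Circuit families from definable queries -/

/-- Circuit number `m` uses `N = √m`, which is exact on adjacency matrices. The outputs follow the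
enumeration of triples, and the triple of row `p` and column `j` has number `p N² + j`, as in a
matrix written row by row. -/
theorem Definable.exists_family {maj : Bool} {P : Query} (hP : Definable maj 3 P) :
    ∃ C : CircuitFamily, C.IsTC0 ∧ (maj = false → C.IsAC0) ∧
      ∀ N (x : List Bool), x.length = N * N →
        ∃ B : Fin N → Fin (N * N) → Bool, (C (N * N)).output x = matrixBits B ∧
          ∀ p j, (B p j = true ↔ P N (rel N x) [j.val % N, j.val / N, p.val]) := by
  obtain ⟨g, hg, -, b, hb⟩ := hP _ (isStage_nil maj)
  have hsq : ∀ m : ℕ, m.sqrt * m.sqrt ≤ m := Nat.sqrt_le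
  set C : CircuitFamily := fun m => ⟨g m m.sqrt, (tuples m.sqrt 3).map
    fun t => b m m.sqrt + index m.sqrt t⟩ with hC
  have hTC : C.IsTC0 := by
    refine ⟨fun m => ⟨?_, ?_, ?_⟩, ?_, ?_, ?_⟩
    · exact hg.args_lt m _ (hsq m)
    · exact hg.not_unary m _
    · intro o ho
      obtain ⟨t, ht, rfl⟩ := List.mem_map.1 ho
      exact hb.lt m _ (hsq m) t ht
    · obtain ⟨c, hc⟩ := hg.size
      have h3 : 1 ≤ 3 ^ c := Nat.one_le_pow _ _ (by norm_num)
      -- For `m ≥ 2` one has `m + 2 ≤ m²`, whence the exponent `2c`; the additive `3 ^ c` covers `m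
      -- < 2`.
      refine ⟨2 * c + 3 ^ c, fun m => (hc m _ (hsq m)).trans ?_⟩
      rcases Nat.lt_or_ge m 2 with hm | hm
      · have : (m + 2) ^ c ≤ 3 ^ c := Nat.pow_le_pow_left (by omega) c
        omega
      · have h1 : m + 2 ≤ m ^ 2 := by nlinarith
        calc (m + 2) ^ c ≤ (m ^ 2) ^ c := Nat.pow_le_pow_left h1 c
          _ = m ^ (2 * c) := (pow_mul _ _ _).symm
          _ ≤ m ^ (2 * c + 3 ^ c) := Nat.pow_le_pow_right (by omega) (by omega)
          _ ≤ _ := by omega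
    · obtain ⟨D, hD⟩ := hg.depth
      exact ⟨D, fun m => foldr_max_le (hD m _ (hsq m))⟩
    · refine Gen.logspace (f := fun m N _ => Circuit.encode m ⟨g m N, (tuples N 3).map
        fun t => b m N + index N t⟩) ?_
      have h1 := TickGen.encodeNode (TickGen.reg (isReg_m 0))
      have h2 := gen_tuples (TickGen.encodeNode (tickGen_address hb.tickGen 3))
      refine ((h1.append hg.gen).append (Gen.cons .out h2)).congr fun m N t _ => ?_
      simp [Circuit.encode, List.flatMap_map]
  refine ⟨C, hTC, fun hm => ⟨hTC, fun m => hg.noMaj hm m _⟩, fun N x hx => ?_⟩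
  classical
  refine ⟨fun p j => decide (P N (rel N x) [j.val % N, j.val / N, p.val]), ?_, by simp⟩
  have h1 : (C (N * N)).output x = (tuples N 3).map fun t => decide (P N (rel N x) t) := by
    simp only [Circuit.output, hC, Nat.sqrt_eq, List.map_map]
    refine List.map_congr_left fun t ht => ?_
    have := hb.value (N * N) N le_rfl x hx t ht
    rw [Bool.eq_iff_iff, decide_eq_true_eq, ← this]
    rfl
  rw [h1, matrixBits]
  apply List.ext_getElem?
  intro i
  have hpow : N ^ 3 = N * (N * N) := by ring
  rcases Nat.lt_or_ge i (N * (N * N)) with hi | hi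
  · have hN : 0 < N := by
      rcases Nat.eq_zero_or_pos N with rfl | h
      · simp at hi
      · exact h
    set p := i / (N * N) with hp
    set j := i % (N * N) with hj
    have hpN : p < N := Nat.div_lt_of_lt_mul (by rwa [mul_comm] at hi)
    have hjN : j < N * N := Nat.mod_lt _ (by positivity)
    have hmem : [j % N, j / N, p] ∈ tuples N 3 := by
      rw [mem_tuples]
      refine ⟨rfl, ?_⟩
      simp only [List.mem_cons, List.not_mem_nil, or_false, forall_eq_or_imp, forall_eq]
      exact ⟨Nat.mod_lt _ hN, Nat.div_lt_of_lt_mul hjN, hpN⟩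
    have hidx : index N [j % N, j / N, p] = i := by
      have e1 := Nat.div_add_mod i (N * N)
      have e2 := Nat.div_add_mod j N
      simp only [index]
      rw [← hp, ← hj] at e1
      nlinarith
    have h2 := getElem?_tuples hmem
    rw [hidx] at h2
    rw [List.getElem?_map, h2]
    simp [hi, Fin.coe_divNat, Fin.coe_modNat, ← hp, ← hj]
    rw [hj, Nat.mod_mul_left_mod]
  · rw [List.getElem?_eq_none (by simpa [length_tuples, hpow] using hi),
      List.getElem?_eq_none (by simpa using hi)]

end Layered

/-! ### Nets -/

namespace IsNet

theorem mem_edgeNhd {P : Type} [Fintype P] {G : SimpleGraph P} {u v z : P} :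
    z ∈ edgeNhd G u v ↔ z = u ∨ z = v ∨ (G.Adj u z ∧ G.Adj v z) := by
  simp [edgeNhd]

theorem isClique_line {P : Type} {lines : Finset (Finset P)} {l : Finset P} (hl : l ∈ lines) :
    (netGraph lines).IsClique (l : Set P) :=
  fun _ hx _ hy hxy => ⟨hxy, l, hl, hx, hy⟩

variable {P : Type} [Fintype P] [DecidableEq P] {n k : ℕ} {lines : Finset (Finset P)}

theorem eq_of_mem (h : IsNet n k lines) {l l' : Finset P} (hl : l ∈ lines) (hl' : l' ∈ lines)
    {u v : P} (huv : u ≠ v) (hu : u ∈ l) (hv : v ∈ l) (hu' : u ∈ l') (hv' : v ∈ l') : l = l' := by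
  by_contra hne
  obtain ⟨cls, hcls⟩ := h.parallel
  obtain ⟨h1, h2⟩ := hcls l hl l' hl' hne
  by_cases hc : cls l = cls l'
  · exact Finset.disjoint_left.1 (h1 hc) hu hu'
  · obtain ⟨z, hz⟩ := Finset.card_eq_one.1 (h2 hc)
    have hu1 : u ∈ l ∩ l' := Finset.mem_inter.2 ⟨hu, hu'⟩
    have hv1 : v ∈ l ∩ l' := Finset.mem_inter.2 ⟨hv, hv'⟩
    rw [hz, Finset.mem_singleton] at hu1 hv1
    exact huv (hu1.trans hv1.symm)

theorem existsUnique_line (h : IsNet n k lines) {u v : P} (huv : (netGraph lines).Adj u v) :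
    ∃! l : Finset P, l ∈ lines ∧ u ∈ l ∧ v ∈ l := by
  obtain ⟨hne, l, hl, hu, hv⟩ := huv
  exact ⟨l, ⟨hl, hu, hv⟩, fun l' ⟨hl', hu', hv'⟩ => h.eq_of_mem hl' hl hne hu' hv' hu hv⟩

theorem line_subset_edgeNhd {l : Finset P} (hl : l ∈ lines) {u v : P} (hu : u ∈ l) (hv : v ∈ l) :
    l ⊆ edgeNhd (netGraph lines) u v := by
  intro z hz
  rw [mem_edgeNhd]
  by_cases h1 : z = u
  · exact Or.inl h1
  by_cases h2 : z = v
  · exact Or.inr (Or.inl h2)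
  exact Or.inr (Or.inr ⟨⟨Ne.symm h1, l, hl, hu, hz⟩, ⟨Ne.symm h2, l, hl, hv, hz⟩⟩)

theorem le_degreeIn (h : IsNet n k lines) {l : Finset P} (hl : l ∈ lines) {u v w : P}
    (hu : u ∈ l) (hv : v ∈ l) (hw : w ∈ l) :
    n - 1 ≤ degreeIn (netGraph lines) (edgeNhd (netGraph lines) u v) w := by
  classical
  rw [← h.card_line l hl, ← Finset.card_erase_of_mem hw, degreeIn]
  refine Finset.card_le_card fun z hz => ?_
  obtain ⟨hzw, hz⟩ := Finset.mem_erase.1 hz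
  exact Finset.mem_filter.2 ⟨line_subset_edgeNhd hl hu hv hz, hzw.symm, l, hl, hw, hz⟩

/-- At most `k - 1` neighbours lie on `l`, and at most `(k - 1)(k - 2)` points of `H` lie off `l`,
of which `w` is one and not its own neighbour. The total is at most `(k - 1)² - 1`. -/
theorem degreeIn_lt (h : IsNet n k lines) {u v : P} (huv : u ≠ v) {l : Finset P} (hl : l ∈ lines)
    (hu : u ∈ l) (hv : v ∈ l) {w : P} (hw : w ∈ edgeNhd (netGraph lines) u v) (hwl : w ∉ l) :
    degreeIn (netGraph lines) (edgeNhd (netGraph lines) u v) w < (k - 1) ^ 2 := by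
  classical
  obtain ⟨cls, hcls⟩ := h.parallel
  set G := netGraph lines
  set H := edgeNhd G u v
  have hpar : ∀ {l₁ l₂ : Finset P} {z : P}, l₁ ∈ lines → l₂ ∈ lines → z ∈ l₁ → z ∈ l₂ →
      cls l₁ = cls l₂ → l₁ = l₂ := by
    intro l₁ l₂ z h1 h2 hz1 hz2 hc
    by_contra hne
    exact Finset.disjoint_left.1 ((hcls l₁ h1 l₂ h2 hne).1 hc) hz1 hz2
  have hex : ∀ x y : P, ∃ m : Finset P, G.Adj x y → m ∈ lines ∧ x ∈ m ∧ y ∈ m := by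
    intro x y
    by_cases hxy : G.Adj x y
    · obtain ⟨-, m, hm⟩ := hxy
      exact ⟨m, fun _ => hm⟩
    · exact ⟨∅, fun h => absurd h hxy⟩
  choose L hL using hex
  set K := Finset.univ.erase (cls l)
  have hK : K.card = k - 1 := by
    rw [Finset.card_erase_of_mem (Finset.mem_univ _), Finset.card_univ, Fintype.card_fin]
  -- A line joining a point of `l` to a point off `l` meets `l` without being `l`, so it is not
  -- parallel to `l`.
  have hoff : ∀ x z : P, G.Adj x z → ∀ y ∈ l, (x = y ∨ z = y) → (x ∉ l ∨ z ∉ l) →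
      cls (L x z) ∈ K := by
    intro x z hxz y hy hxy hnot
    obtain ⟨h1, h2, h3⟩ := hL x z hxz
    refine Finset.mem_erase.2 ⟨fun hc => ?_, Finset.mem_univ _⟩
    have : y ∈ L x z := by rcases hxy with rfl | rfl <;> assumption
    have he := hpar h1 hl this hy hc
    rw [he] at h2 h3
    tauto
  -- Two neighbours on `l` seen from `w` in the same class would be on one line through `w`; it
  -- would meet `l` twice, hence be `l`, although `w` is not on `l`.
  have hA : (l.filter fun z => G.Adj w z).card ≤ k - 1 := by
    rw [← hK]
    refine Finset.card_le_card_of_injOn (fun z => cls (L w z)) ?_ ?_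
    · intro z hz
      have hz := Finset.mem_filter.1 hz
      exact hoff w z hz.2 z hz.1 (Or.inr rfl) (Or.inl hwl)
    · intro z hz z' hz' he
      have hz := Finset.mem_filter.1 hz
      have hz' := Finset.mem_filter.1 hz'
      obtain ⟨h1, h2, h3⟩ := hL w z hz.2
      obtain ⟨h1', h2', h3'⟩ := hL w z' hz'.2
      have hee := hpar h1 h1' h2 h2' he
      by_contra hne
      rw [← hee] at h3'
      have := h.eq_of_mem h1 hl hne h3 h3' hz.1 hz'.1
      exact hwl (this ▸ h2)
  -- The lines `uz` and `vz` have different classes, since otherwise they would coincide, contain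
  -- `u` and `v`, and be `l`. For the same reason they meet only in `z`, so the pair of classes
  -- determines `z`.
  have hB : (H.filter fun z => z ∉ l).card ≤ (k - 1) * (k - 1) - (k - 1) := by
    rw [← hK, ← Finset.offDiag_card]
    have hadj : ∀ z ∈ H.filter fun z => z ∉ l, z ∉ l ∧ G.Adj u z ∧ G.Adj v z := by
      intro z hz
      obtain ⟨hz1, hz2⟩ := Finset.mem_filter.1 hz
      rcases mem_edgeNhd.1 hz1 with rfl | rfl | h
      · exact absurd hu hz2
      · exact absurd hv hz2
      · exact ⟨hz2, h⟩
    refine Finset.card_le_card_of_injOn (fun z => (cls (L u z), cls (L v z))) ?_ ?_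
    · intro z hz
      obtain ⟨hzl, hzu, hzv⟩ := hadj z hz
      refine Finset.mem_offDiag.2 ⟨hoff u z hzu u hu (Or.inl rfl) (Or.inr hzl),
        hoff v z hzv v hv (Or.inl rfl) (Or.inr hzl), fun hc => ?_⟩
      obtain ⟨h1, h2, h3⟩ := hL u z hzu
      obtain ⟨h1', h2', h3'⟩ := hL v z hzv
      have he := hpar h1 h1' h3 h3' hc
      rw [← he] at h2'
      have := h.eq_of_mem h1 hl huv h2 h2' hu hv
      exact hzl (this ▸ h3)
    · intro z hz z' hz' he
      obtain ⟨hzl, hzu, hzv⟩ := hadj z hz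
      obtain ⟨hzl', hzu', hzv'⟩ := hadj z' hz'
      obtain ⟨he1, he2⟩ := Prod.mk.inj he
      obtain ⟨h1, h2, h3⟩ := hL u z hzu
      obtain ⟨h1', h2', h3'⟩ := hL v z hzv
      obtain ⟨h4, h5, h6⟩ := hL u z' hzu'
      obtain ⟨h4', h5', h6'⟩ := hL v z' hzv'
      have e1 := hpar h1 h4 h2 h5 he1
      have e2 := hpar h1' h4' h2' h5' he2
      by_contra hne
      rw [← e1] at h6
      rw [← e2] at h6'
      have e3 := h.eq_of_mem h1 h1' hne h3 h6 h3' h6'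
      rw [← e3] at h2'
      have := h.eq_of_mem h1 hl huv h2 h2' hu hv
      exact hzl (this ▸ h3)
  have hwB : w ∈ H.filter fun z => z ∉ l := Finset.mem_filter.2 ⟨hw, hwl⟩
  have hsub : (H.filter fun z => G.Adj w z) ⊆
      (l.filter fun z => G.Adj w z) ∪ (H.filter fun z => z ∉ l).erase w := by
    intro z hz
    obtain ⟨hz1, hz2⟩ := Finset.mem_filter.1 hz
    by_cases hzl : z ∈ l
    · exact Finset.mem_union_left _ (Finset.mem_filter.2 ⟨hzl, hz2⟩)
    · exact Finset.mem_union_right _ (Finset.mem_erase.2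
        ⟨hz2.ne', Finset.mem_filter.2 ⟨hz1, hzl⟩⟩)
  have h1 := (Finset.card_le_card hsub).trans (Finset.card_union_le _ _)
  rw [Finset.card_erase_of_mem hwB] at h1
  -- Since `w` is such a point, none of the subtractions of natural numbers is truncated.
  have h2 : 0 < (H.filter fun z => z ∉ l).card := Finset.card_pos.2 ⟨w, hwB⟩
  have h3 : degreeIn G H w = (H.filter fun z => G.Adj w z).card := rfl
  rw [h3, sq]
  omega

theorem mem_line_iff (h : IsNet n k lines) (hk : (k - 1) ^ 2 < n) {u v : P} (huv : u ≠ v)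
    {l : Finset P} (hl : l ∈ lines) (hu : u ∈ l) (hv : v ∈ l) (w : P) :
    w ∈ l ↔ w ∈ edgeNhd (netGraph lines) u v ∧
      n - 1 ≤ degreeIn (netGraph lines) (edgeNhd (netGraph lines) u v) w := by
  refine ⟨fun hw => ⟨line_subset_edgeNhd hl hu hv hw, h.le_degreeIn hl hu hv hw⟩,
    fun ⟨hw, hd⟩ => ?_⟩
  by_contra hwl
  have := h.degreeIn_lt huv hl hu hv hw hwl
  omega

end IsNet

/-! ### The first two points of a line -/

section FirstPair

variable {N : ℕ}

/-- The pair consists of the first two points of the set `l`. -/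
def IsFirstPair (l : Finset (Fin N)) (z : Fin N × Fin N) : Prop :=
  z.1 ∈ l ∧ z.2 ∈ l ∧ z.1 < z.2 ∧ ∀ w ∈ l, w < z.2 → w = z.1

theorem exists_isFirstPair {l : Finset (Fin N)} (hl : 2 ≤ l.card) : ∃ z, IsFirstPair l z := by
  have h1 : l.Nonempty := Finset.card_pos.1 (by omega)
  have h2 : (l.erase (l.min' h1)).Nonempty := by
    rw [← Finset.card_pos, Finset.card_erase_of_mem (l.min'_mem h1)]
    omega
  have h3 := Finset.mem_erase.1 ((l.erase (l.min' h1)).min'_mem h2)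
  refine ⟨(l.min' h1, (l.erase (l.min' h1)).min' h2), l.min'_mem h1, h3.2,
    lt_of_le_of_ne (l.min'_le _ h3.2) (Ne.symm h3.1), fun w hw hlt => ?_⟩
  by_contra hne
  exact absurd (Finset.min'_le _ _ (Finset.mem_erase.2 ⟨hne, hw⟩)) (not_le.2 hlt)

theorem IsFirstPair.unique {l : Finset (Fin N)} {z z' : Fin N × Fin N} (h : IsFirstPair l z)
    (h' : IsFirstPair l z') : z = z' := by
  obtain ⟨h1, h2, h3, h4⟩ := h
  obtain ⟨h1', h2', h3', h4'⟩ := h'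
  have h5 : z.2 = z'.2 := by
    rcases lt_trichotomy z.2 z'.2 with hlt | h | hlt
    · have e1 := h4' _ h2 hlt
      have e2 := h4' _ h1 (h3.trans hlt)
      exact absurd (e2.trans e1.symm) h3.ne
    · exact h
    · have e1 := h4 _ h2' hlt
      have e2 := h4 _ h1' (h3'.trans hlt)
      exact absurd (e2.trans e1.symm) h3'.ne
  exact Prod.ext (h4' _ h1 (h5 ▸ h3)) h5

end FirstPair

/-! ### Counting up to a constant by quantifiers -/

namespace Layered

-- The largest counted element is split off. Iterating this a fixed number of times expresses a
-- constant threshold by nested existential quantifiers, hence without majority gates.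
open Classical in
theorem succ_le_count_iff (p : ℕ → Prop) (s b : ℕ) :
    s + 1 ≤ Nat.count p b ↔ ∃ x < b, p x ∧ s ≤ Nat.count p x := by
  induction b with
  | zero => simp
  | succ b ih =>
    rw [Nat.count_succ]
    constructor
    · intro h
      by_cases hp : p b
      · rw [if_pos hp] at h
        exact ⟨b, by omega, hp, by omega⟩
      · rw [if_neg hp] at h
        obtain ⟨x, hx, h⟩ := ih.1 h
        exact ⟨x, by omega, h⟩
    · rintro ⟨x, hx, hp, hs⟩
      rcases (Nat.lt_succ_iff.1 hx).eq_or_lt with rfl | hlt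
      · rw [if_pos hp]
        omega
      · exact (ih.2 ⟨x, hlt, hp, hs⟩).trans (Nat.le_add_right _ _)

namespace Definable

variable {maj : Bool} {d : ℕ}

open Classical in
theorem le_count_below {p : ℕ → (ℕ → ℕ → Prop) → ℕ → ℕ → ℕ → ℕ → Prop}
    (hp : Definable maj 4 fun N A t => p N A (t.getD 3 0) (t.getD 2 0) (t.getD 1 0) (t.getD 0 0))
    (s : ℕ) : Definable maj 4 fun N A t =>
      s ≤ Nat.count (p N A (t.getD 3 0) (t.getD 2 0) (t.getD 1 0)) (t.getD 0 0) := by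
  induction s with
  | zero => exact const_true.congr fun _ _ _ _ => by simp
  | succ s ih =>
    -- The new variable has place `0` and the old bound place `1`; the selection `[0, 2, 3, 4]`
    -- makes the new variable the bound of the smaller count.
    refine (((lt (d := 5) (i := 0) (j := 1) (by norm_num) (by norm_num)).and
      ((hp.comap (d := 5) [0, 2, 3, 4] (by simp)).and
        (ih.comap (d := 5) [0, 2, 3, 4] (by simp)))).exists_lt).congr fun N A t ht => ?_
    rw [succ_le_count_iff]
    have ht0 : t.getD 0 0 < N := by
      obtain ⟨h1, h2⟩ := mem_tuples.1 ht
      rw [List.getD_eq_getElem _ _ (by omega)]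
      exact h2 _ (List.getElem_mem _)
    exact ⟨fun ⟨x, hx, h⟩ => ⟨x, hx.trans ht0, hx, h⟩, fun ⟨x, _, hx, h⟩ => ⟨x, hx, h⟩⟩

open Classical in
theorem le_count {p : ℕ → (ℕ → ℕ → Prop) → ℕ → ℕ → ℕ → ℕ → Prop}
    (hp : Definable maj 4 fun N A t => p N A (t.getD 3 0) (t.getD 2 0) (t.getD 1 0) (t.getD 0 0))
    (s : ℕ) : Definable maj 3 fun N A t =>
      s ≤ Nat.count (p N A (t.getD 2 0) (t.getD 1 0) (t.getD 0 0)) N := by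
  cases s with
  | zero => exact const_true.congr fun _ _ _ _ => by simp
  | succ s =>
    refine ((hp.and (le_count_below hp s)).exists_lt).congr fun N A t ht => ?_
    rw [succ_le_count_iff]
    rfl

end Definable

/-! ### The queries of the reconstruction -/

/-- The closed neighbourhood of an edge. -/
def InNhd (A : ℕ → ℕ → Prop) (u v z : ℕ) : Prop := z = u ∨ z = v ∨ (A u z ∧ A v z)

/-- The neighbours of `w` in the closed neighbourhood of the edge `uv`. -/
def NhdAdj (A : ℕ → ℕ → Prop) (u v w z : ℕ) : Prop := InNhd A u v z ∧ A w z

/-- The points of the line through `u` and `v`, by a comparison of numbers of pairs. -/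
def MajLine (N : ℕ) (A : ℕ → ℕ → Prop) (u v w : ℕ) : Prop :=
  InNhd A u v w ∧ pairCount N (fun y z => y = z) ≤
    pairCount N fun y z => (y = w ∨ NhdAdj A u v w y) ∧ (z = w ∨ NhdAdj A u v w z)

open Classical in
/-- The points of the line through `u` and `v`, by thresholds that are at most `c`. -/
def BoundedLine (c N : ℕ) (A : ℕ → ℕ → Prop) (u v w : ℕ) : Prop :=
  InNhd A u v w ∧ (c ≤ Nat.count (NhdAdj A u v w) N ∨
    ∃ s < c, N ≤ (s + 1) ^ 2 ∧ s ≤ Nat.count (NhdAdj A u v w) N)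

/-- The points `u` and `v` are the first two points of their line. -/
def FirstPair (line : ℕ → (ℕ → ℕ → Prop) → ℕ → ℕ → ℕ → Prop) (N : ℕ) (A : ℕ → ℕ → Prop)
    (u v : ℕ) : Prop :=
  A u v ∧ u < v ∧ ∀ w < N, w < v → line N A u v w → w = u

/-- There is at most one point. -/
def Trivial (N : ℕ) : Prop := ¬ ∃ x < N, ∃ y < N, x < y

/-- The lexicographic order of pairs. -/
def LexLt (a b u v : ℕ) : Prop := a < u ∨ a = u ∧ b < v

/-- The entries of the matrix whose column `(u, v)` is the line with the first points `u, v`. -/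
def SparseEntry (line : ℕ → (ℕ → ℕ → Prop) → ℕ → ℕ → ℕ → Prop) (N : ℕ) (A : ℕ → ℕ → Prop)
    (p u v : ℕ) : Prop :=
  Trivial N ∨ FirstPair line N A u v ∧ line N A u v p

/-- The entries of the matrix whose columns are the lines in the order of their first points. -/
def RankedEntry (line : ℕ → (ℕ → ℕ → Prop) → ℕ → ℕ → ℕ → Prop) (N : ℕ) (A : ℕ → ℕ → Prop)
    (p c c' : ℕ) : Prop :=
  Trivial N ∨ ∃ u < N, ∃ v < N, (FirstPair line N A u v ∧ line N A u v p) ∧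
    pairCount N (fun a b => FirstPair line N A a b ∧ LexLt a b u v) ≤
      pairCount N (fun a b => LexLt a b c c') ∧
    pairCount N (fun a b => LexLt a b c c') ≤
      pairCount N fun a b => FirstPair line N A a b ∧ LexLt a b u v

/-! ### Definability of the reconstruction queries -/

namespace Definable

variable {maj : Bool} {d : ℕ}

theorem inNhd {i j k : ℕ} (hi : i < d) (hj : j < d) (hk : k < d) :
    Definable maj d fun _ A t => InNhd A (t.getD i 0) (t.getD j 0) (t.getD k 0) :=
  (eq hk hi).or ((eq hk hj).or ((adj hi hk).and (adj hj hk)))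

theorem nhdAdj {i j k l : ℕ} (hi : i < d) (hj : j < d) (hk : k < d) (hl : l < d) :
    Definable maj d fun _ A t =>
      NhdAdj A (t.getD i 0) (t.getD j 0) (t.getD k 0) (t.getD l 0) :=
  (inNhd hi hj hl).and (adj hk hl)

theorem majLine :
    Definable true 3 fun N A t => MajLine N A (t.getD 2 0) (t.getD 1 0) (t.getD 0 0) := by
  refine (inNhd (i := 2) (j := 1) (k := 0) (by norm_num) (by norm_num) (by norm_num)).and
    (Definable.pairCount_le (d := 3)
      (P := fun N A t => (t.getD 1 0 = t.getD 2 0 ∨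
        NhdAdj A (t.getD 4 0) (t.getD 3 0) (t.getD 2 0) (t.getD 1 0)) ∧
        (t.getD 0 0 = t.getD 2 0 ∨
        NhdAdj A (t.getD 4 0) (t.getD 3 0) (t.getD 2 0) (t.getD 0 0)))
      (Q := fun N A t => t.getD 1 0 = t.getD 0 0) ?_ ?_)
  · exact ((eq (by norm_num) (by norm_num)).or
      (nhdAdj (by norm_num) (by norm_num) (by norm_num) (by norm_num))).and
      ((eq (by norm_num) (by norm_num)).or
      (nhdAdj (by norm_num) (by norm_num) (by norm_num) (by norm_num)))
  · exact eq (by norm_num) (by norm_num)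

theorem exists_lt_const {P : ℕ → Query} (h : ∀ s, Definable maj d (P s)) (c : ℕ) :
    Definable maj d fun N A t => ∃ s < c, P s N A t := by
  induction c with
  | zero => exact (const_true.not).congr fun _ _ _ _ => by simp
  | succ c ih =>
    refine (ih.or (h c)).congr fun N A t _ => ?_
    constructor
    · rintro ⟨s, hs, hp⟩
      rcases (Nat.lt_succ_iff.1 hs).eq_or_lt with rfl | hlt
      · exact Or.inr hp
      · exact Or.inl ⟨s, hlt, hp⟩
    · rintro (⟨s, hs, hp⟩ | hp)
      · exact ⟨s, by omega, hp⟩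
      · exact ⟨c, by omega, hp⟩

theorem boundedLine (c : ℕ) :
    Definable maj 3 fun N A t => BoundedLine c N A (t.getD 2 0) (t.getD 1 0) (t.getD 0 0) := by
  have h1 := fun s => le_count (maj := maj) (p := fun _ A => NhdAdj A)
    (nhdAdj (by norm_num) (by norm_num) (by norm_num) (by norm_num)) s
  -- A constant bound on `N` says that there are not `s + 1` numbers below `N`.
  have h2 : ∀ s, Definable maj 3 fun N _ _ => N ≤ s := fun s =>
    (le_count (p := fun _ _ _ _ _ _ => True) const_true (s + 1)).not.congr
      fun N _ _ _ => by simp [Nat.count_eq_card_filter_range]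
  exact (inNhd (by norm_num) (by norm_num) (by norm_num)).and
    ((h1 c).or (exists_lt_const (fun s => (h2 ((s + 1) ^ 2)).and (h1 s)) c))

theorem trivial : Definable maj d fun N _ _ => Trivial N :=
  (lt (d := d + 2) (i := 1) (j := 0) (by omega) (by omega)).exists_lt.exists_lt.not

theorem lexLt {i j k l : ℕ} (hi : i < d) (hj : j < d) (hk : k < d) (hl : l < d) :
    Definable maj d fun _ _ t =>
      LexLt (t.getD i 0) (t.getD j 0) (t.getD k 0) (t.getD l 0) :=
  (lt hi hk).or ((eq hi hk).and (lt hj hl))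

section Line

variable {line : ℕ → (ℕ → ℕ → Prop) → ℕ → ℕ → ℕ → Prop}

theorem line_comap
    (hl : Definable maj 3 fun N A t => line N A (t.getD 2 0) (t.getD 1 0) (t.getD 0 0))
    {i j k : ℕ} (hi : i < d) (hj : j < d) (hk : k < d) :
    Definable maj d fun N A t => line N A (t.getD i 0) (t.getD j 0) (t.getD k 0) :=
  hl.comap (d := d) [k, j, i] (by simp [hi, hj, hk])

theorem firstPair
    (hl : Definable maj 3 fun N A t => line N A (t.getD 2 0) (t.getD 1 0) (t.getD 0 0))
    {i j : ℕ} (hi : i < d) (hj : j < d) :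
    Definable maj d fun N A t => FirstPair line N A (t.getD i 0) (t.getD j 0) :=
  (adj hi hj).and ((lt hi hj).and
    ((lt (d := d + 1) (i := 0) (j := j + 1) (by omega) (by omega)).imp
      ((line_comap hl (d := d + 1) (i := i + 1) (j := j + 1) (k := 0) (by omega) (by omega)
        (by omega)).imp (eq (i := 0) (j := i + 1) (by omega) (by omega)))).forall_lt)

theorem sparseEntry
    (hl : Definable maj 3 fun N A t => line N A (t.getD 2 0) (t.getD 1 0) (t.getD 0 0)) :
    Definable maj 3 fun N A t =>
      SparseEntry line N A (t.getD 2 0) (t.getD 1 0) (t.getD 0 0) :=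
  trivial.or ((firstPair hl (by norm_num) (by norm_num)).and
    (line_comap hl (by norm_num) (by norm_num) (by norm_num)))

theorem rankedEntry
    (hl : Definable true 3 fun N A t => line N A (t.getD 2 0) (t.getD 1 0) (t.getD 0 0)) :
    Definable true 3 fun N A t =>
      RankedEntry line N A (t.getD 2 0) (t.getD 1 0) (t.getD 0 0) := by
  -- The entries of the 7-tuple are, in this order, `b, a, v, u, c', c, p`.
  have h1 : Definable true 7 fun N A t => FirstPair line N A (t.getD 1 0) (t.getD 0 0) ∧
      LexLt (t.getD 1 0) (t.getD 0 0) (t.getD 3 0) (t.getD 2 0) :=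
    (firstPair hl (by norm_num) (by norm_num)).and
      (lexLt (by norm_num) (by norm_num) (by norm_num) (by norm_num))
  have h2 : Definable true 7 fun N A t =>
      LexLt (t.getD 1 0) (t.getD 0 0) (t.getD 5 0) (t.getD 4 0) :=
    lexLt (by norm_num) (by norm_num) (by norm_num) (by norm_num)
  have h3 : Definable true 5 fun N A t => FirstPair line N A (t.getD 1 0) (t.getD 0 0) ∧
      line N A (t.getD 1 0) (t.getD 0 0) (t.getD 4 0) :=
    (firstPair hl (by norm_num) (by norm_num)).and
      (line_comap hl (by norm_num) (by norm_num) (by norm_num))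
  exact trivial.or (((h3.and ((pairCount_le (d := 5) h2 h1).and
    (pairCount_le (d := 5) h1 h2))).exists_lt).exists_lt)

end Line

end Definable

end Layered

/-! ### Translation between bit strings, numbers and graphs on `Fin N` -/

namespace Layered

section Bridge

variable {N : ℕ}

theorem length_graphBits (G : SimpleGraph (Fin N)) : (graphBits G).length = N * N := by
  simp [graphBits, matrixBits]

theorem pair_lt (u v : Fin N) : (u : ℕ) * N + v < N * N := by
  have h1 : ((u : ℕ) + 1) * N ≤ N * N := Nat.mul_le_mul_right N u.2
  have h2 := v.2
  rw [Nat.succ_mul] at h1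
  omega

theorem pair_div (u v : Fin N) : ((u : ℕ) * N + v) / N = u := by
  rw [mul_comm, Nat.mul_add_div (by have := u.2; omega), Nat.div_eq_of_lt v.2, add_zero]

theorem pair_mod (u v : Fin N) : ((u : ℕ) * N + v) % N = v := by
  rw [mul_comm, Nat.mul_add_mod, Nat.mod_eq_of_lt v.2]

theorem rel_graphBits (G : SimpleGraph (Fin N)) (u v : Fin N) :
    rel N (graphBits G) u v ↔ G.Adj u v := by
  have h := pair_lt u v
  have h1 : (⟨u * N + v, h⟩ : Fin (N * N)).divNat = u := Fin.ext (by
    rw [Fin.coe_divNat]; exact pair_div u v)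
  have h2 : (⟨u * N + v, h⟩ : Fin (N * N)).modNat = v := Fin.ext (by
    rw [Fin.coe_modNat]; exact pair_mod u v)
  simp only [rel, graphBits, matrixBits, List.getD]
  rw [List.getElem?_ofFn]
  simp [h, h1, h2]

open Classical in
theorem card_filter_fin (p : ℕ → Prop) :
    (Finset.univ.filter fun z : Fin N => p z).card = ((Finset.range N).filter p).card := by
  rw [← Finset.card_map Fin.valEmbedding]
  congr 1
  ext x
  simp only [Finset.mem_map, Finset.mem_filter, Finset.mem_univ, true_and, Finset.mem_range,
    Fin.valEmbedding_apply]
  exact ⟨fun ⟨z, hz, h⟩ => h ▸ ⟨z.2, hz⟩, fun ⟨h, hp⟩ => ⟨⟨x, h⟩, hp, rfl⟩⟩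

theorem inNhd_iff (G : SimpleGraph (Fin N)) (u v z : Fin N) :
    InNhd (rel N (graphBits G)) u v z ↔ z ∈ edgeNhd G u v := by
  simp [InNhd, edgeNhd, rel_graphBits, Fin.ext_iff]

open Classical in
theorem card_nhdAdj (G : SimpleGraph (Fin N)) (u v w : Fin N) :
    ((Finset.range N).filter (NhdAdj (rel N (graphBits G)) u v w)).card =
      degreeIn G (edgeNhd G u v) w := by
  rw [← card_filter_fin, degreeIn]
  congr 1
  ext z
  simp [NhdAdj, inNhd_iff, rel_graphBits]

theorem pairCount_eq_self : pairCount N (fun y z => y = z) = N := by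
  refine (congrArg Finset.card ?_).trans ((Finset.diag_card _).trans (Finset.card_range N))
  ext z
  simp only [Finset.mem_filter, Finset.mem_product, Finset.mem_diag]
  constructor
  · rintro ⟨⟨h1, -⟩, h⟩
    exact ⟨h1, h⟩
  · rintro ⟨h1, h⟩
    exact ⟨⟨h1, h ▸ h1⟩, h⟩

open Classical in
theorem pairCount_and (p : ℕ → Prop) :
    pairCount N (fun y z => p y ∧ p z) = ((Finset.range N).filter p).card ^ 2 := by
  rw [pairCount, sq, ← Finset.card_product]
  congr 1
  ext z
  simp only [Finset.mem_filter, Finset.mem_product]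
  tauto

open Classical in
theorem pairCount_eq_card (p : ℕ → ℕ → Prop) :
    pairCount N p = ((Finset.range (N * N)).filter fun j => p (j / N) (j % N)).card := by
  rw [pairCount]
  refine Finset.card_bij' (fun z _ => z.1 * N + z.2) (fun j _ => (j / N, j % N)) ?_ ?_ ?_ ?_
  · rintro ⟨a, b⟩ h
    simp only [Finset.mem_filter, Finset.mem_product, Finset.mem_range] at h ⊢
    have := pair_lt (⟨a, h.1.1⟩ : Fin N) ⟨b, h.1.2⟩
    have h1 := pair_div (⟨a, h.1.1⟩ : Fin N) ⟨b, h.1.2⟩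
    have h2 := pair_mod (⟨a, h.1.1⟩ : Fin N) ⟨b, h.1.2⟩
    simp only at this h1 h2
    rw [h1, h2]
    exact ⟨this, h.2⟩
  · intro j h
    simp only [Finset.mem_filter, Finset.mem_product, Finset.mem_range] at h ⊢
    have hN : 0 < N := Nat.pos_of_ne_zero (by rintro rfl; simp at h)
    exact ⟨⟨Nat.div_lt_of_lt_mul h.1, Nat.mod_lt _ hN⟩, h.2⟩
  · rintro ⟨a, b⟩ h
    simp only [Finset.mem_filter, Finset.mem_product, Finset.mem_range] at h
    have h1 := pair_div (⟨a, h.1.1⟩ : Fin N) ⟨b, h.1.2⟩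
    have h2 := pair_mod (⟨a, h.1.1⟩ : Fin N) ⟨b, h.1.2⟩
    simp only at h1 h2
    rw [h1, h2]
  · intro j _
    exact Nat.div_add_mod' j N

end Bridge

/-! ### Correctness of the reconstruction -/

section Correctness

variable {N n k : ℕ} {lines : Finset (Finset (Fin N))}

/-- The query `line` computes the line through two adjacent points. -/
def IsLineQuery (line : ℕ → (ℕ → ℕ → Prop) → ℕ → ℕ → ℕ → Prop)
    (lines : Finset (Finset (Fin N))) : Prop :=
  ∀ l ∈ lines, ∀ u v : Fin N, u ≠ v → u ∈ l → v ∈ l → ∀ w : Fin N,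
    (line N (rel N (graphBits (netGraph lines))) u v w ↔ w ∈ l)

/-- The diagonal has `N = n²` pairs, and the pairs from `w` and its neighbours in `H` number `(deg +
1)²`. Comparing the squares is the test `n - 1 ≤ deg`, without extracting `n`. -/
theorem isLineQuery_majLine (h : IsNet n k lines) (hk : (k - 1) ^ 2 < n) :
    IsLineQuery MajLine lines := by
  classical
  intro l hl u v huv hu hv w
  rw [h.mem_line_iff hk huv hl hu hv w, MajLine, inNhd_iff]
  refine and_congr_right fun _ => ?_
  have hcard : pairCount N (fun y z =>
      (y = (w : ℕ) ∨ NhdAdj (rel N (graphBits (netGraph lines))) u v w y) ∧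
      (z = (w : ℕ) ∨ NhdAdj (rel N (graphBits (netGraph lines))) u v w z)) =
        (degreeIn (netGraph lines) (edgeNhd (netGraph lines) u v) w + 1) ^ 2 := by
    rw [pairCount_and fun y => y = (w : ℕ) ∨ NhdAdj _ u v w y]
    congr 1
    rw [← card_nhdAdj, ← Finset.card_insert_of_notMem (a := (w : ℕ))]
    · congr 1
      ext x
      simp only [Finset.mem_filter, Finset.mem_insert, Finset.mem_range]
      constructor
      · tauto
      · rintro (rfl | hx)
        · exact ⟨w.2, Or.inl rfl⟩
        · exact ⟨hx.1, Or.inr hx.2⟩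
    · intro hx
      exact ((rel_graphBits _ w w).1 (Finset.mem_filter.1 hx).2.2).ne rfl
  have hN : N = n ^ 2 := by simpa using h.card_points
  rw [pairCount_eq_self, hcard]
  generalize degreeIn (netGraph lines) (edgeNhd (netGraph lines) u v) w = e
  have hpow : n ^ 2 ≤ (e + 1) ^ 2 ↔ n ≤ e + 1 := Nat.pow_le_pow_iff_left two_ne_zero
  omega

/-- Put `c = (K - 1)²`. Degrees off the line are below `(k - 1)² ≤ c`, so if `n - 1 ≥ c` the
threshold `c` separates. Otherwise `s = n - 1` is below `c`, and `N ≤ (s + 1)²` expresses `n - 1 ≤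
s`. -/
theorem isLineQuery_boundedLine (h : IsNet n k lines) (hk : (k - 1) ^ 2 < n) {K : ℕ}
    (hK : k ≤ K) : IsLineQuery (BoundedLine ((K - 1) ^ 2)) lines := by
  classical
  intro l hl u v huv hu hv w
  have hN : N = n ^ 2 := by simpa using h.card_points
  have hc : (k - 1) ^ 2 ≤ (K - 1) ^ 2 := Nat.pow_le_pow_left (by omega) 2
  simp only [BoundedLine]
  rw [inNhd_iff, Nat.count_eq_card_filter_range, card_nhdAdj]
  constructor
  · rintro ⟨hw, hd⟩
    by_contra hwl
    have hlt := h.degreeIn_lt huv hl hu hv hw hwl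
    rcases hd with hd | ⟨s, -, hs, hd⟩
    · omega
    · rw [hN, Nat.pow_le_pow_iff_left two_ne_zero] at hs
      omega
  · intro hw
    obtain ⟨hw', hd⟩ := (h.mem_line_iff hk huv hl hu hv w).1 hw
    refine ⟨hw', ?_⟩
    rcases Nat.lt_or_ge (n - 1) ((K - 1) ^ 2) with hs | hs
    · refine Or.inr ⟨n - 1, hs, ?_, hd⟩
      rw [hN, Nat.sub_add_cancel h.one_le_order]
    · exact Or.inl (hs.trans hd)

variable {line : ℕ → (ℕ → ℕ → Prop) → ℕ → ℕ → ℕ → Prop}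

theorem firstPair_iff (hline : IsLineQuery line lines) (z : Fin N × Fin N) :
    FirstPair line N (rel N (graphBits (netGraph lines))) z.1 z.2 ↔
      ∃ l ∈ lines, IsFirstPair l z := by
  obtain ⟨u, v⟩ := z
  simp only [FirstPair, rel_graphBits, IsFirstPair, Fin.val_fin_lt]
  constructor
  · rintro ⟨⟨hne, l, hl, hu, hv⟩, huv, hw⟩
    exact ⟨l, hl, hu, hv, huv, fun w hwl hwv =>
      Fin.ext (hw w w.2 hwv ((hline l hl u v hne hu hv w).2 hwl))⟩
  · rintro ⟨l, hl, hu, hv, huv, hw⟩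
    refine ⟨⟨huv.ne, l, hl, hu, hv⟩, huv, fun w hwN hwv hwl => ?_⟩
    exact congrArg Fin.val (hw ⟨w, hwN⟩ ((hline l hl u v huv.ne hu hv ⟨w, hwN⟩).1 hwl) hwv)

theorem trivial_iff : Trivial N ↔ N ≤ 1 := by
  constructor
  · intro h
    by_contra hN
    exact h ⟨0, by omega, 1, by omega, by omega⟩
  · rintro h ⟨x, hx, y, hy, hxy⟩
    omega

/-- The numbers of the first pairs of the lines. -/
structure IsKey (lines : Finset (Finset (Fin N))) (key : lines ↪ Fin (N * N)) : Prop where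
  isFirstPair : ∀ l : lines, IsFirstPair l.1 ((key l).divNat, (key l).modNat)

/-- Different lines have different keys because two points determine their line. -/
theorem exists_isKey (h : IsNet n k lines) (hn : 2 ≤ n) :
    ∃ key : lines ↪ Fin (N * N), IsKey lines key := by
  choose φ hφ using fun l : lines => exists_isFirstPair (by rw [h.card_line l.1 l.2]; exact hn)
  have hinj : Function.Injective φ := by
    intro l l' he
    have h1 := hφ l
    have h2 := hφ l'
    rw [← he] at h2
    exact Subtype.ext (h.eq_of_mem l.2 l'.2 h1.2.2.1.ne h1.1 h1.2.1 h2.1 h2.2.1)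
  refine ⟨⟨fun l => finProdFinEquiv (φ l), fun l l' he => hinj (finProdFinEquiv.injective he)⟩,
    ⟨fun l => ?_⟩⟩
  have : finProdFinEquiv.symm (finProdFinEquiv (φ l)) = φ l := Equiv.symm_apply_apply _ _
  rw [finProdFinEquiv_symm_apply] at this
  exact this.symm ▸ hφ l

theorem IsKey.firstPair_iff {key : lines ↪ Fin (N * N)} (hkey : IsKey lines key)
    (hline : IsLineQuery line lines) (j : Fin (N * N)) :
    FirstPair line N (rel N (graphBits (netGraph lines))) (j / N : ℕ) (j % N : ℕ) ↔
      ∃ l, key l = j := by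
  have := Layered.firstPair_iff hline (j.divNat, j.modNat)
  rw [Fin.coe_divNat, Fin.coe_modNat] at this
  rw [this]
  constructor
  · rintro ⟨l, hl, hp⟩
    refine ⟨⟨l, hl⟩, ?_⟩
    have he := (hkey.isFirstPair ⟨l, hl⟩).unique hp
    apply finProdFinEquiv.symm.injective
    rw [finProdFinEquiv_symm_apply, finProdFinEquiv_symm_apply]
    exact he
  · rintro ⟨l, rfl⟩
    exact ⟨l, l.2, hkey.isFirstPair l⟩

theorem IsKey.line_iff {key : lines ↪ Fin (N * N)} (hkey : IsKey lines key)
    (hline : IsLineQuery line lines) (l : lines) (p : Fin N) :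
    line N (rel N (graphBits (netGraph lines))) (key l / N : ℕ) (key l % N : ℕ) p ↔ p ∈ l.1 := by
  obtain ⟨h1, h2, h3, -⟩ := hkey.isFirstPair l
  have := hline l.1 l.2 _ _ h3.ne h1 h2 p
  rwa [Fin.coe_divNat, Fin.coe_modNat] at this

/-- A net with one point has no pair of points that could name a line. Its only line is the whole
point set, so the matrix with the single entry `1` is correct; this is the role of `Trivial` in the
queries. -/
theorem isIncidenceMatrix_of_le_one (h : IsNet n k lines) (hN : N ≤ 1)
    {B : Fin N → Fin (N * N) → Bool} (hB : ∀ p j, B p j = true) : IsIncidenceMatrix lines B := by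
  have hn := h.one_le_order
  have hNn : N = n ^ 2 := by simpa using h.card_points
  obtain rfl : n = 1 := by nlinarith
  obtain rfl : N = 1 := by simpa using hNn
  have huniv : ∀ l ∈ lines, l = Finset.univ := fun l hl =>
    (Finset.card_eq_iff_eq_univ l).1 (by simp [h.card_line l hl])
  have hsub : Subsingleton lines :=
    ⟨fun l l' => Subtype.ext ((huniv l l.2).trans (huniv l' l'.2).symm)⟩
  refine ⟨⟨fun _ => 0, fun l l' _ => Subsingleton.elim _ _⟩, ⟨fun l => ?_, fun j hj => ?_⟩,
    fun l => Finset.card_pos.2 ⟨l, l.2⟩⟩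
  · rw [huniv l l.2]
    ext p
    simp [column, hB]
  · have hc : 0 < lines.card := by
      rw [h.card_lines]
      have := h.one_le_degree
      omega
    obtain ⟨l, hl⟩ := Finset.card_pos.1 hc
    exact absurd ⟨⟨l, hl⟩, Subsingleton.elim (α := Fin 1) _ _⟩ hj

theorem isSparseIncidenceMatrix_sparseEntry (h : IsNet n k lines)
    (hline : IsLineQuery line lines) {B : Fin N → Fin (N * N) → Bool}
    (hB : ∀ p j, (B p j = true ↔ SparseEntry line N (rel N (graphBits (netGraph lines)))
      p (j / N : ℕ) (j % N : ℕ))) : IsSparseIncidenceMatrix lines B := by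
  rcases Nat.lt_or_ge 1 N with hN | hN
  · have hn : 2 ≤ n := by
      have hNn : N = n ^ 2 := by simpa using h.card_points
      nlinarith
    obtain ⟨key, hkey⟩ := exists_isKey h hn
    have hT : ¬ Trivial N := fun ht => by rw [trivial_iff] at ht; omega
    refine ⟨key, fun l => ?_, fun j hj => ?_⟩
    · ext p
      simp only [column, Finset.mem_filter, Finset.mem_univ, true_and, hB, SparseEntry, hT,
        false_or]
      rw [hkey.firstPair_iff hline, hkey.line_iff hline]
      exact and_iff_right ⟨l, rfl⟩
    · ext p
      simp only [column, Finset.mem_filter, Finset.mem_univ, true_and, hB, SparseEntry, hT,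
        false_or, Finset.notMem_empty, iff_false]
      rw [hkey.firstPair_iff hline]
      exact fun hp => hj hp.1
  · obtain ⟨f, hf, -⟩ := isIncidenceMatrix_of_le_one h hN
      fun p j => (hB p j).2 (Or.inl (trivial_iff.2 hN))
    exact ⟨f, hf⟩

theorem lexLt_iff {a b u v : ℕ} (hb : b < N) (hv : v < N) :
    LexLt a b u v ↔ a * N + b < u * N + v := by
  unfold LexLt
  rcases lt_trichotomy a u with h | rfl | h
  · have : (a + 1) * N ≤ u * N := Nat.mul_le_mul_right N h
    rw [Nat.succ_mul] at this
    simp only [h, true_or, true_iff]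
    omega
  · simp
  · have : (u + 1) * N ≤ a * N := Nat.mul_le_mul_right N h
    rw [Nat.succ_mul] at this
    constructor
    · rintro (h' | ⟨h', -⟩) <;> omega
    · intro h'
      omega

open Classical in
/-- The number of lines with a smaller key. -/
noncomputable def keyRank (key : lines ↪ Fin (N * N)) (l : lines) : ℕ :=
  (Finset.univ.filter fun l' => key l' < key l).card

theorem keyRank_lt (key : lines ↪ Fin (N * N)) (l : lines) : keyRank key l < lines.card := by
  classical
  rw [keyRank, ← Fintype.card_coe lines, ← Finset.card_univ]
  exact Finset.card_lt_card ((Finset.filter_ssubset).2 ⟨l, Finset.mem_univ _, lt_irrefl _⟩)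

theorem keyRank_injective (key : lines ↪ Fin (N * N)) : Function.Injective (keyRank key) := by
  classical
  have hlt : ∀ l l', key l < key l' → keyRank key l < keyRank key l' := by
    intro l l' h
    refine Finset.card_lt_card ⟨fun x hx => ?_, fun hs => ?_⟩
    · simp only [Finset.mem_filter, Finset.mem_univ, true_and] at hx ⊢
      exact hx.trans h
    · have := hs (Finset.mem_filter.2 ⟨Finset.mem_univ l, h⟩)
      simp at this
  intro l l' he
  rcases lt_trichotomy (key l) (key l') with h | h | h
  · exact absurd he (hlt _ _ h).ne
  · exact key.injective h
  · exact absurd he (hlt _ _ h).ne'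

/-- A column number thus becomes a pair count itself, and can be compared with a rank by majority
gates. -/
theorem pairCount_lexLt (j : Fin (N * N)) :
    pairCount N (fun a b => LexLt a b (j / N : ℕ) (j % N : ℕ)) = j := by
  classical
  have hN : 0 < N := Nat.pos_of_ne_zero (by rintro rfl; exact absurd j.2 (by simp))
  rw [pairCount_eq_card]
  have : ((Finset.range (N * N)).filter fun i => LexLt (i / N) (i % N) (j / N : ℕ) (j % N : ℕ)) =
      Finset.range j := by
    ext i
    simp only [Finset.mem_filter, Finset.mem_range]
    rw [lexLt_iff (Nat.mod_lt _ hN) (Nat.mod_lt _ hN), Nat.div_add_mod', Nat.div_add_mod']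
    have := j.2
    omega
  rw [this, Finset.card_range]

theorem IsKey.pairCount_eq {key : lines ↪ Fin (N * N)} (hkey : IsKey lines key)
    (hline : IsLineQuery line lines) (l : lines) :
    pairCount N (fun a b => FirstPair line N (rel N (graphBits (netGraph lines))) a b ∧
      LexLt a b (key l / N : ℕ) (key l % N : ℕ)) = keyRank key l := by
  classical
  have hN : 0 < N := Nat.pos_of_ne_zero (by rintro rfl; exact absurd (key l).2 (by simp))
  rw [pairCount_eq_card, ← card_filter_fin (fun i => FirstPair line N _ (i / N) (i % N) ∧
      LexLt (i / N) (i % N) (key l / N : ℕ) (key l % N : ℕ)), keyRank, ← Finset.card_map key]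
  congr 1
  ext i
  simp only [Finset.mem_filter, Finset.mem_univ, true_and, Finset.mem_map]
  rw [hkey.firstPair_iff hline, lexLt_iff (Nat.mod_lt _ hN) (Nat.mod_lt _ hN),
    Nat.div_add_mod', Nat.div_add_mod']
  constructor
  · rintro ⟨⟨l', rfl⟩, h⟩
    exact ⟨l', h, rfl⟩
  · rintro ⟨l', h, rfl⟩
    exact ⟨⟨l', rfl⟩, h⟩

/-- The two inequalities of `RankedEntry` force the column number to be the rank of the key of the
line. Ranks are distinct and less than the number of lines, so the lines fill exactly the first
columns. -/
theorem isIncidenceMatrix_rankedEntry (h : IsNet n k lines)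
    (hline : IsLineQuery line lines) {B : Fin N → Fin (N * N) → Bool}
    (hB : ∀ p j, (B p j = true ↔ RankedEntry line N (rel N (graphBits (netGraph lines)))
      p (j / N : ℕ) (j % N : ℕ))) : IsIncidenceMatrix lines B := by
  rcases Nat.lt_or_ge 1 N with hN | hN
  · have hn : 2 ≤ n := by
      have hNn : N = n ^ 2 := by simpa using h.card_points
      nlinarith
    obtain ⟨key, hkey⟩ := exists_isKey h hn
    have hT : ¬ Trivial N := fun ht => by rw [trivial_iff] at ht; omega
    have hentry : ∀ p j, B p j = true ↔ ∃ l : lines, p ∈ l.1 ∧ keyRank key l = j := by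
      intro p j
      rw [hB, RankedEntry, or_iff_right hT]
      constructor
      · rintro ⟨u, hu, v, hv, ⟨hf, hp⟩, h1, h2⟩
        have hlt := pair_lt (⟨u, hu⟩ : Fin N) ⟨v, hv⟩
        have hd : (u * N + v) / N = u := pair_div (⟨u, hu⟩ : Fin N) ⟨v, hv⟩
        have hm : (u * N + v) % N = v := pair_mod (⟨u, hu⟩ : Fin N) ⟨v, hv⟩
        have hk := hkey.firstPair_iff hline ⟨u * N + v, hlt⟩
        simp only [hd, hm] at hk
        obtain ⟨l, hl⟩ := hk.1 hf
        have hu' : (key l : ℕ) / N = u := by rw [hl]; exact hd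
        have hv' : (key l : ℕ) % N = v := by rw [hl]; exact hm
        rw [← hu', ← hv'] at hp h1 h2
        rw [hkey.pairCount_eq hline, pairCount_lexLt] at h1 h2
        exact ⟨l, (hkey.line_iff hline l p).1 hp, le_antisymm h1 h2⟩
      · rintro ⟨l, hp, hj⟩
        have hlt := (key l).2
        refine ⟨_, Nat.div_lt_of_lt_mul hlt, _, Nat.mod_lt (key l : ℕ) (by omega),
          ⟨(hkey.firstPair_iff hline _).2 ⟨l, rfl⟩, (hkey.line_iff hline l p).2 hp⟩, ?_⟩
        rw [hkey.pairCount_eq hline, pairCount_lexLt, hj]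
        exact ⟨le_rfl, le_rfl⟩
    -- The keys embed the lines into the pairs of points, so every rank is the number of an existing
    -- column.
    have hcard : lines.card ≤ N * N := by
      simpa using Fintype.card_le_of_embedding key
    refine ⟨⟨fun l => ⟨keyRank key l, (keyRank_lt key l).trans_le hcard⟩, fun l l' he =>
      keyRank_injective key (congrArg Fin.val he)⟩, ⟨fun l => ?_, fun j hj => ?_⟩,
      keyRank_lt key⟩
    · ext p
      simp only [column, Finset.mem_filter, Finset.mem_univ, true_and, hentry]
      constructor
      · rintro ⟨l', hp, he⟩
        rwa [← keyRank_injective key he]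
      · exact fun hp => ⟨l, hp, rfl⟩
    · ext p
      simp only [column, Finset.mem_filter, Finset.mem_univ, true_and, hentry,
        Finset.notMem_empty, iff_false]
      rintro ⟨l, -, he⟩
      exact hj ⟨l, Fin.ext he⟩
  · exact isIncidenceMatrix_of_le_one h hN
      fun p j => (hB p j).2 (Or.inl (trivial_iff.2 hN))

end Correctness

end Layered

/-! ### Reconstruction of nets and the clique of an edge -/

theorem mainTheorem10 :
    -- one family of `TC⁰` circuits, for all `n` and `k`
    (∃ C : CircuitFamily, C.IsTC0 ∧
      ∀ (N n k : ℕ) (lines : Finset (Finset (Fin N))) (G : SimpleGraph (Fin N)),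
        IsNet n k lines → G = netGraph lines → (k - 1) ^ 2 < n →
        ∃ B : Fin N → Fin (N * N) → Bool,
          (C (N * N)).output (graphBits G) = matrixBits B ∧ IsIncidenceMatrix lines B) ∧
    -- for every bound `K`, one family of `AC⁰` circuits for all `n` and all `k ≤ K`
    (∀ K : ℕ, ∃ C : CircuitFamily, C.IsAC0 ∧
      ∀ (N n k : ℕ) (lines : Finset (Finset (Fin N))) (G : SimpleGraph (Fin N)),
        IsNet n k lines → G = netGraph lines → (k - 1) ^ 2 < n → k ≤ K →
        ∃ B : Fin N → Fin (N * N) → Bool,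
          (C (N * N)).output (graphBits G) = matrixBits B ∧ IsSparseIncidenceMatrix lines B) ∧
    -- the line through two adjacent points, as a clique separated by degrees
    (∀ (N n k : ℕ) (lines : Finset (Finset (Fin N))) (G : SimpleGraph (Fin N)),
      IsNet n k lines → G = netGraph lines → (k - 1) ^ 2 < n →
      ∀ u v : Fin N, G.Adj u v →
        (∃! l : Finset (Fin N), l ∈ lines ∧ u ∈ l ∧ v ∈ l) ∧
        ∀ l ∈ lines, u ∈ l → v ∈ l →
          l ⊆ edgeNhd G u v ∧ G.IsClique (l : Set (Fin N)) ∧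
          (∀ w ∈ l, n - 1 ≤ degreeIn G (edgeNhd G u v) w) ∧
          (∀ w ∈ edgeNhd G u v, w ∉ l → degreeIn G (edgeNhd G u v) w < (k - 1) ^ 2)) := by
  refine ⟨?_, fun K => ?_, fun N n k lines G h hG hk u v huv => ?_⟩
  · obtain ⟨C, hC, -, hout⟩ := (Layered.Definable.rankedEntry Layered.Definable.majLine).exists_family
    refine ⟨C, hC, fun N n k lines G h hG hk => ?_⟩
    subst hG
    obtain ⟨B, hB, hval⟩ := hout N _ (Layered.length_graphBits _)
    exact ⟨B, hB, Layered.isIncidenceMatrix_rankedEntry h (Layered.isLineQuery_majLine h hk) hval⟩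
  · obtain ⟨C, -, hC, hout⟩ := (Layered.Definable.sparseEntry (maj := false)
      (Layered.Definable.boundedLine ((K - 1) ^ 2))).exists_family
    refine ⟨C, hC rfl, fun N n k lines G h hG hk hK => ?_⟩
    subst hG
    obtain ⟨B, hB, hval⟩ := hout N _ (Layered.length_graphBits _)
    exact ⟨B, hB, Layered.isSparseIncidenceMatrix_sparseEntry h (Layered.isLineQuery_boundedLine h hk hK) hval⟩
  · subst hG
    refine ⟨h.existsUnique_line huv, fun l hl hu hv => ⟨IsNet.line_subset_edgeNhd hl hu hv,
      IsNet.isClique_line hl, fun w hw => h.le_degreeIn hl hu hv hw,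
      fun w hw hwl => h.degreeIn_lt huv.ne hl hu hv hw hwl⟩⟩
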